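/- Let $(N_1,g_1)$ and $(N_2,g_2)$ be smooth Riemannian manifolds of dimensions $n_1\ge 2$ and $n_2$, let $f:N_1\to(0,\infty)$ be smooth, let $M=N_1\times_f N_2$ be the warped product, i.e. $N_1\times N_2$ with the metric $g_1+f^2g_2$, of dimension $n=n_1+n_2$, and let $\varphi:M\to\tilde M^m(c)$ be an isometric immersion into an $m$-dimensional Riemannian manifold of constant sectional curvature $c$. Let $$\vec H=\frac1n\sum_{i=1}^n h(e_i,e_i)$$ be its mean curvature vector ($h$ the second fundamental form, $(e_i)$ an orthonormal basis of the tangent space of $M$); $\varphi$ is minimal if $\vec H\equiv 0$. For $x=(x_1,x_2)\in M$ write $$\delta_{N_1}(x)=\sum_{1\le a<b\le n_1}K_{N_1}(e_a\wedge e_b)-\inf\{K_{N_1}(\pi_1):\pi_1\subset T_{x_1}N_1,\ \dim\pi_1=2\}$$ for Chen's first invariant of $N_1$ at $x_1$ ($(e_a)$ an orthonormal basis of $T_{x_1}N_1$), and let $\Delta f=\sum_a\big((\nabla_{e_a}e_a)f-e_ae_af\big)$ be the Laplacian of $f$ on $N_1$ with this sign (minus the trace of the Hessian), where $\Delta f$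 and $f$ are evaluated at $x_1$. Then: (a) (necessary condition for minimality) if $\varphi$ is minimal, then for every $x\in M$ $$\delta_{N_1}(x)+\frac{n_2\,\Delta f}{f}\le \tfrac12 n_1(n_1+2n_2-1)c-c .$$ (b) Without assuming minimality, for every $x\in M$ $$\delta_{N_1}(x)+\frac{n_2\,\Delta f}{f}\le \frac{n^2}{2}\|\vec H(x)\|^2+\tfrac12 n_1(n_1+2n_2-1)c-c ,$$ and if equality holds at $x$, then $\vec H(x)=0$. In particular, if equality holds at every point, then $\varphi$ is minimal. -/

import Mathlib

open Bundle Manifold Set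
open scoped ContDiff

noncomputable section

namespace WarpedChen

/-! ### Levi-Civita connection and curvature of a metric on an open set of a vector space

`G p` is the inner product at the point `p`; `u v w` are constant (coordinate) vector fields. -/

section Local

variable {E : Type*} [NormedAddCommGroup E] [NormedSpace ℝ E]

/-- The covector `w ↦ ½ (∂_u G(v,w) + ∂_v G(u,w) - ∂_w G(u,v))` at `p`
(Christoffel symbols of the first kind). -/
def christoffelFirst (G : E → E →L[ℝ] E →L[ℝ] ℝ) (p u v : E) : E →L[ℝ] ℝ :=
  (1 / 2 : ℝ) • (fderiv ℝ G p u v + fderiv ℝ G p v u - ((fderiv ℝ G p).flip u).flip v)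

/-- The Christoffel symbol `Γ_p(u,v) = (∇_u v)(p)`: the vector such that
`G_p(Γ_p(u,v), w) = ½ (∂_u G(v,w) + ∂_v G(u,w) - ∂_w G(u,v))` for all `w`. -/
def christoffel (G : E → E →L[ℝ] E →L[ℝ] ℝ) (p u v : E) : E :=
  (G p).inverse (christoffelFirst G p u v)

/-- The curvature tensor `R(u,v)w = ∇_u ∇_v w - ∇_v ∇_u w` at `p`. -/
def curvatureLocal (G : E → E →L[ℝ] E →L[ℝ] ℝ) (p u v w : E) : E :=
  fderiv ℝ (fun q => christoffel G q v w) p u - fderiv ℝ (fun q => christoffel G q u w) p v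
    + christoffel G p u (christoffel G p v w) - christoffel G p v (christoffel G p u w)

/-- `e` is an orthonormal basis for the inner product `B`. -/
def IsOrthonormalFrame (B : E →L[ℝ] E →L[ℝ] ℝ) (e : Fin (Module.finrank ℝ E) → E) : Prop :=
  ∀ i j, B (e i) (e j) = if i = j then 1 else 0

/-- A positive definite symmetric form has an orthonormal frame. -/
theorem exists_isOrthonormalFrame [FiniteDimensional ℝ E] (B : E →L[ℝ] E →L[ℝ] ℝ)
    (hs : ∀ u v, B u v = B v u) (hp : ∀ v, v ≠ 0 → 0 < B v v) :
    ∃ e, IsOrthonormalFrame B e := by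
  let BL : LinearMap.BilinForm ℝ E :=
    (ContinuousLinearMap.coeLM ℝ).comp B.toLinearMap
  obtain ⟨v, hv⟩ := LinearMap.BilinForm.exists_orthogonal_basis (B := BL) ⟨fun u w => hs u w⟩
  have hvp : ∀ i, 0 < B (v i) (v i) := fun i => hp _ (v.ne_zero i)
  refine ⟨fun i => (Real.sqrt (B (v i) (v i)))⁻¹ • v i, fun i j => ?_⟩
  have hi := Real.sqrt_pos.2 (hvp i)
  split_ifs with h
  · subst h
    have := Real.mul_self_sqrt (hvp i).le
    simp only [map_smul, smul_apply, smul_eq_mul]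
    field_simp
    rw [Real.sq_sqrt (hvp i).le]
  · have : B (v i) (v j) = 0 := hv h
    simp [this]

theorem contMDiffAt_combination {M : Type*} [TopologicalSpace M] {H : Type*} [TopologicalSpace H]
    [ChartedSpace H M] {I : ModelWithCorners ℝ E H}
    {V₁ V₂ W : Type*} [NormedAddCommGroup V₁] [NormedSpace ℝ V₁]
    [NormedAddCommGroup V₂] [NormedSpace ℝ V₂] [NormedAddCommGroup W] [NormedSpace ℝ W]
    {a : M → V₁} {b : M → V₂} {s : M → ℝ} {x : M} (ha : ContMDiffAt I 𝓘(ℝ, V₁) ∞ a x)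
    (hb : ContMDiffAt I 𝓘(ℝ, V₂) ∞ b x) (hs : ContMDiffAt I 𝓘(ℝ, ℝ) ∞ s x)
    (L₁ : V₁ →L[ℝ] W) (L₂ : V₂ →L[ℝ] W) :
    ContMDiffAt I 𝓘(ℝ, W) ∞ (fun y => L₁ (a y) + s y ^ 2 • L₂ (b y)) x :=
  (L₁.contMDiff.contMDiffAt.comp x ha).add
    ((hs.pow 2).smul (L₂.contMDiff.contMDiffAt.comp x hb))

end Local

/-! ### Riemannian manifolds

A tangent vector at `x` is an element of `TangentSpace I x`, which is by definition the model vector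
space `E`, through the derivative of the preferred chart `extChartAt I x`. Geometric quantities at
`x` are computed in that chart. The models below are boundaryless. -/

section Metric

variable {E : Type*} [NormedAddCommGroup E] [NormedSpace ℝ E] {H : Type*} [TopologicalSpace H]
  (I : ModelWithCorners ℝ E H) (M : Type*) [TopologicalSpace M] [ChartedSpace H M]
  [IsManifold I ∞ M]

/-- Smooth Riemannian metrics on the manifold `M`. -/
abbrev SmoothMetric :=
  ContMDiffRiemannianMetric I ∞ E (fun x : M => TangentSpace I x)

end Metric

section Geometry

variable {E : Type*} [NormedAddCommGroup E] [NormedSpace ℝ E] {H : Type*} [TopologicalSpace H]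
  {I : ModelWithCorners ℝ E H} {M : Type*} [TopologicalSpace M] [ChartedSpace H M]
  [IsManifold I ∞ M]

/-- The inner product of the metric on the tangent space at `x`. -/
def metricAt (g : SmoothMetric I M) (x : M) : E →L[ℝ] E →L[ℝ] ℝ := g.inner x

/-- The metric in the preferred chart at `x`, i.e. its pullback by the inverse of that chart. -/
def metricInChart (g : SmoothMetric I M) (x : M) (p : E) : E →L[ℝ] E →L[ℝ] ℝ :=
  (metricAt g ((extChartAt I x).symm p)).bilinearComp
    (mfderiv 𝓘(ℝ, E) I (extChartAt I x).symm p : E →L[ℝ] E)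
    (mfderiv 𝓘(ℝ, E) I (extChartAt I x).symm p : E →L[ℝ] E)

/-- The Christoffel symbol at the point `x` in the preferred chart at `x`. -/
def christoffelAt (g : SmoothMetric I M) (x : M) (u v : E) : E :=
  christoffel (metricInChart g x) (extChartAt I x x) u v

/-- The Riemann curvature tensor `R(u,v)w` at `x`. -/
def curvatureAt (g : SmoothMetric I M) (x : M) (u v w : E) : E :=
  curvatureLocal (metricInChart g x) (extChartAt I x x) u v w

/-- The sectional curvature `g(R(u,v)v,u) / (g(u,u) g(v,v) - g(u,v)²)` at `x` of the plane spanned by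
the linearly independent tangent vectors `u` and `v`. -/
def sectionalCurvature (g : SmoothMetric I M) (x : M) (u v : E) : ℝ :=
  metricAt g x (curvatureAt g x u v v) u /
    (metricAt g x u u * metricAt g x v v - metricAt g x u v ^ 2)

/-- All sectional curvatures are equal to `c`: `M` is a real space form `M(c)`. -/
def HasConstantCurvature (g : SmoothMetric I M) (c : ℝ) : Prop :=
  ∀ (x : M) (u v : E), LinearIndependent ℝ ![u, v] → sectionalCurvature g x u v = c

/-- An orthonormal basis of the tangent space at `x`. The traces formed with it below do not depend
on the choice. -/
def orthonormalFrame [FiniteDimensional ℝ E] (g : SmoothMetric I M) (x : M) :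
    Fin (Module.finrank ℝ E) → E :=
  (exists_isOrthonormalFrame (metricAt g x) (g.symm x) (g.pos x)).choose

theorem isOrthonormalFrame_orthonormalFrame [FiniteDimensional ℝ E] (g : SmoothMetric I M) (x : M) :
    IsOrthonormalFrame (metricAt g x) (orthonormalFrame g x) :=
  (exists_isOrthonormalFrame (metricAt g x) (g.symm x) (g.pos x)).choose_spec

/-- The scalar curvature `τ = ∑_{i < j} K(e_i ∧ e_j)` at `x`. -/
def scalarCurvature [FiniteDimensional ℝ E] (g : SmoothMetric I M) (x : M) : ℝ :=
  ∑ i, ∑ j ∈ Finset.Ioi i,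
    sectionalCurvature g x (orthonormalFrame g x i) (orthonormalFrame g x j)

/-- Chen's first invariant `δ(x) = τ(x) - inf K(π)`, the infimum over all tangent planes at `x`. -/
def chenInvariant [FiniteDimensional ℝ E] (g : SmoothMetric I M) (x : M) : ℝ :=
  scalarCurvature g x -
    sInf {k : ℝ | ∃ u v : E, LinearIndependent ℝ ![u, v] ∧ sectionalCurvature g x u v = k}

/-- The Laplacian with the sign convention `Δψ = ∑ ((∇_{e_i} e_i) ψ - e_i e_i ψ)`, that is minus the
trace of the Hessian `D²ψ(u,v) - Dψ(Γ(u,v))`. -/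
def laplacian [FiniteDimensional ℝ E] (g : SmoothMetric I M) (ψ : M → ℝ) (x : M) : ℝ :=
  ∑ i, (fderiv ℝ (ψ ∘ (extChartAt I x).symm) (extChartAt I x x)
        (christoffelAt g x (orthonormalFrame g x i) (orthonormalFrame g x i))
      - fderiv ℝ (fderiv ℝ (ψ ∘ (extChartAt I x).symm)) (extChartAt I x x)
        (orthonormalFrame g x i) (orthonormalFrame g x i))

theorem contMDiffAt_metric_iff (B : ∀ x : M, TangentSpace I x →L[ℝ] TangentSpace I x →L[ℝ] ℝ)
    (x₀ : M) :
    ContMDiffAt I (I.prod 𝓘(ℝ, E →L[ℝ] E →L[ℝ] ℝ)) ∞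
      (fun b ↦ TotalSpace.mk' (E →L[ℝ] E →L[ℝ] ℝ)
        (E := fun x : M => TangentSpace I x →L[ℝ] TangentSpace I x →L[ℝ] ℝ) b (B b)) x₀ ↔
    ContMDiffAt I 𝓘(ℝ, E →L[ℝ] E →L[ℝ] ℝ) ∞
      (fun b ↦ ContinuousLinearMap.bilinearComp (E := E) (F := E) (B b)
        (tangentCoordChange I x₀ b b) (tangentCoordChange I x₀ b b)) x₀ := by
  rw [contMDiffAt_section]
  apply Filter.EventuallyEq.contMDiffAt_iff
  have : (chartAt H x₀).source ∈ nhds x₀ := chart_source_mem_nhds H x₀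
  filter_upwards [this] with b hb
  ext u v
  rw [hom_trivializationAt_apply]
  erw [inCoordinates_apply_eq₂ hb hb (Set.mem_univ _)]
  have key : ∀ w : E, (trivializationAt E (TangentSpace I) x₀).symm b w
      = tangentCoordChange I x₀ b b w := by
    intro w
    have h := TangentBundle.symmL_trivializationAt_eq_core (I := I) hb
    exact (Trivialization.symmL_apply (R := ℝ) (trivializationAt E (TangentSpace I) x₀) hb w).symm.trans (congrArg (fun L : E →L[ℝ] E => L w) h)
  erw [Bundle.Trivial.linearMapAt_trivialization]
  change B b ((trivializationAt E (TangentSpace I) x₀).symm b u)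
    ((trivializationAt E (TangentSpace I) x₀).symm b v) = B b (tangentCoordChange I x₀ b b u)
      (tangentCoordChange I x₀ b b v)
  rw [key, key]

end Geometry

/-! ### Isometric immersions -/

section Immersion

variable {E : Type*} [NormedAddCommGroup E] [NormedSpace ℝ E] {H : Type*} [TopologicalSpace H]
  {I : ModelWithCorners ℝ E H} {M : Type*} [TopologicalSpace M] [ChartedSpace H M]
  [IsManifold I ∞ M]
  {E' : Type*} [NormedAddCommGroup E'] [NormedSpace ℝ E'] {H' : Type*} [TopologicalSpace H']
  {I' : ModelWithCorners ℝ E' H'} {M' : Type*} [TopologicalSpace M'] [ChartedSpace H' M']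
  [IsManifold I' ∞ M']

/-- `φ` is a smooth map with `φ^* g' = g` (hence an immersion). -/
def IsIsometricImmersion (g : SmoothMetric I M) (g' : SmoothMetric I' M') (φ : M → M') : Prop :=
  ContMDiff I I' ∞ φ ∧
    ∀ (x : M) (u v : TangentSpace I x),
      g'.inner (φ x) (mfderiv I I' φ x u) (mfderiv I I' φ x v) = g.inner x u v

/-- The second fundamental form `h(u,v) = ∇'_u (φ_* v) - φ_* (∇_u v)` at `x` (Gauss formula), a
tangent vector of `M'` at `φ x`. With `F` the expression of `φ` in the preferred charts at `x` and
`φ x`, it is `D²F(u,v) + Γ'(DF u, DF v) - DF(Γ(u,v))`. -/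
def secondFundamentalForm (g : SmoothMetric I M) (g' : SmoothMetric I' M') (φ : M → M') (x : M)
    (u v : E) : E' :=
  fderiv ℝ (fderiv ℝ (writtenInExtChartAt I I' x φ)) (extChartAt I x x) u v
    + christoffelAt g' (φ x)
        (fderiv ℝ (writtenInExtChartAt I I' x φ) (extChartAt I x x) u)
        (fderiv ℝ (writtenInExtChartAt I I' x φ) (extChartAt I x x) v)
    - fderiv ℝ (writtenInExtChartAt I I' x φ) (extChartAt I x x) (christoffelAt g x u v)

/-- The mean curvature vector `(1/n) ∑ h(e_i, e_i)` at `x`. -/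
def meanCurvature [FiniteDimensional ℝ E] (g : SmoothMetric I M) (g' : SmoothMetric I' M')
    (φ : M → M') (x : M) : E' :=
  (1 / (Module.finrank ℝ E : ℝ)) •
    ∑ i, secondFundamentalForm g g' φ x (orthonormalFrame g x i) (orthonormalFrame g x i)

/-- `φ` is minimal: its mean curvature vector vanishes identically. -/
def IsMinimalImmersion [FiniteDimensional ℝ E] (g : SmoothMetric I M) (g' : SmoothMetric I' M')
    (φ : M → M') : Prop :=
  ∀ x, meanCurvature g g' φ x = 0

end Immersion

/-! ### Warped products -/

section Warped

variable {E₁ : Type*} [NormedAddCommGroup E₁] [NormedSpace ℝ E₁] {H₁ : Type*} [TopologicalSpace H₁]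
  {I₁ : ModelWithCorners ℝ E₁ H₁} {N₁ : Type*} [TopologicalSpace N₁] [ChartedSpace H₁ N₁]
  [IsManifold I₁ ∞ N₁]
  {E₂ : Type*} [NormedAddCommGroup E₂] [NormedSpace ℝ E₂] {H₂ : Type*} [TopologicalSpace H₂]
  {I₂ : ModelWithCorners ℝ E₂ H₂} {N₂ : Type*} [TopologicalSpace N₂] [ChartedSpace H₂ N₂]
  [IsManifold I₂ ∞ N₂]

theorem fderivWithin_prodMap_aux {f₁ : E₁ → E₁} {f₂ : E₂ → E₂} {A₁ : E₁ →L[ℝ] E₁}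
    {A₂ : E₂ →L[ℝ] E₂} {s₁ : Set E₁} {s₂ : Set E₂} {p₁ : E₁} {p₂ : E₂}
    (h₁ : HasFDerivWithinAt f₁ A₁ s₁ p₁) (h₂ : HasFDerivWithinAt f₂ A₂ s₂ p₂)
    (u₁ : UniqueDiffWithinAt ℝ s₁ p₁) (u₂ : UniqueDiffWithinAt ℝ s₂ p₂) :
    fderivWithin ℝ (Prod.map f₁ f₂) (s₁ ×ˢ s₂) (p₁, p₂) = A₁.prodMap A₂ :=
  (HasFDerivWithinAt.prodMap (s := s₁ ×ˢ s₂) (p₁, p₂) (h₁.mono (fst_image_prod_subset _ _))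
    (h₂.mono (snd_image_prod_subset _ _))).fderivWithin (u₁.prod u₂)

theorem tangentCoordChange_prod (x₀ b : N₁ × N₂) (h₁ : b.1 ∈ (chartAt H₁ x₀.1).source)
    (h₂ : b.2 ∈ (chartAt H₂ x₀.2).source) :
    tangentCoordChange (I₁.prod I₂) x₀ b b =
      (tangentCoordChange I₁ x₀.1 b.1 b.1).prodMap (tangentCoordChange I₂ x₀.2 b.2 b.2) := by
  have e₁ := hasFDerivWithinAt_tangentCoordChange (I := I₁) (x := x₀.1) (y := b.1) (z := b.1)
    ⟨by rwa [extChartAt_source], mem_extChartAt_source b.1⟩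
  have e₂ := hasFDerivWithinAt_tangentCoordChange (I := I₂) (x := x₀.2) (y := b.2) (z := b.2)
    ⟨by rwa [extChartAt_source], mem_extChartAt_source b.2⟩
  have u₁ : UniqueDiffWithinAt ℝ (range I₁) (extChartAt I₁ x₀.1 b.1) :=
    I₁.uniqueDiffWithinAt_image
  have u₂ : UniqueDiffWithinAt ℝ (range I₂) (extChartAt I₂ x₀.2 b.2) :=
    I₂.uniqueDiffWithinAt_image
  have e := fderivWithin_prodMap_aux e₁ e₂ u₁ u₂
  rw [tangentCoordChange_def, I₁.range_prod, extChartAt_prod, extChartAt_prod]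
  exact e

/-- Pullback of bilinear forms by a linear map, as a linear map. -/
def pullbackForm {F F' : Type*} [NormedAddCommGroup F] [NormedSpace ℝ F] [NormedAddCommGroup F']
    [NormedSpace ℝ F'] (A : F' →L[ℝ] F) : (F →L[ℝ] F →L[ℝ] ℝ) →L[ℝ] (F' →L[ℝ] F' →L[ℝ] ℝ) :=
  ((ContinuousLinearMap.compL ℝ F' F (F' →L[ℝ] ℝ)).flip A).comp
    (ContinuousLinearMap.compL ℝ F (F →L[ℝ] ℝ) (F' →L[ℝ] ℝ)
      ((ContinuousLinearMap.compL ℝ F' F ℝ).flip A))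

/-- The inner product `g₁ + f² g₂` on the tangent space `E₁ × E₂` of `N₁ × N₂` at `x`. -/
def warpedForm (g₁ : SmoothMetric I₁ N₁) (g₂ : SmoothMetric I₂ N₂) (f : N₁ → ℝ) (x : N₁ × N₂) :
    E₁ × E₂ →L[ℝ] E₁ × E₂ →L[ℝ] ℝ :=
  (metricAt g₁ x.1).bilinearComp (.fst ℝ E₁ E₂) (.fst ℝ E₁ E₂)
    + f x.1 ^ 2 • (metricAt g₂ x.2).bilinearComp (.snd ℝ E₁ E₂) (.snd ℝ E₁ E₂)

theorem warpedForm_apply (g₁ : SmoothMetric I₁ N₁) (g₂ : SmoothMetric I₂ N₂) (f : N₁ → ℝ)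
    (x : N₁ × N₂) (u v : E₁ × E₂) :
    warpedForm g₁ g₂ f x u v =
      metricAt g₁ x.1 u.1 v.1 + f x.1 ^ 2 * metricAt g₂ x.2 u.2 v.2 := rfl

theorem metricAt_nonneg (g : SmoothMetric I₁ N₁) (x : N₁) (v : E₁) : 0 ≤ metricAt g x v v := by
  by_cases hv : v = 0
  · simp [hv]
  · exact (g.pos x v hv).le

theorem isBounded_metricAt (g : SmoothMetric I₁ N₁) (x : N₁) :
    Bornology.IsBounded {v : E₁ | metricAt g x v v < 1} :=
  (NormedSpace.isVonNBounded_iff ℝ (E := E₁)).1 (g.isVonNBounded x)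

theorem warpedForm_pos (g₁ : SmoothMetric I₁ N₁) (g₂ : SmoothMetric I₂ N₂) (f : N₁ → ℝ)
    (hpos : ∀ p, 0 < f p) (x : N₁ × N₂) (v : E₁ × E₂) (hv : v ≠ 0) :
    0 < warpedForm g₁ g₂ f x v v := by
  rw [warpedForm_apply]
  have h := hpos x.1
  by_cases h₁ : v.1 = 0
  · have h₂ : v.2 ≠ 0 := fun h₂ => hv (Prod.ext h₁ h₂)
    have := g₂.pos x.2 v.2 h₂
    have h₃ : 0 < metricAt g₂ x.2 v.2 v.2 := this
    have := metricAt_nonneg g₁ x.1 v.1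
    positivity
  · have h₃ : 0 < metricAt g₁ x.1 v.1 v.1 := g₁.pos x.1 v.1 h₁
    have := metricAt_nonneg g₂ x.2 v.2
    positivity

theorem warpedForm_isBounded (g₁ : SmoothMetric I₁ N₁) (g₂ : SmoothMetric I₂ N₂) (f : N₁ → ℝ)
    (hpos : ∀ p, 0 < f p) (x : N₁ × N₂) :
    Bornology.IsBounded {v : E₁ × E₂ | warpedForm g₁ g₂ f x v v < 1} := by
  have hf := hpos x.1
  have h₂ : Bornology.IsBounded {w : E₂ | f x.1 ^ 2 * metricAt g₂ x.2 w w < 1} := by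
    refine ((isBounded_metricAt g₂ x.2).smul₀ (f x.1)⁻¹).subset fun w hw => ?_
    refine ⟨f x.1 • w, ?_, by simp [smul_smul, hf.ne']⟩
    simp only [mem_ofPred_eq, map_smul, smul_apply, smul_eq_mul] at hw ⊢
    linarith
  refine ((isBounded_metricAt g₁ x.1).prod h₂).subset fun v hv => ?_
  rw [mem_ofPred_eq, warpedForm_apply] at hv
  have a := metricAt_nonneg g₁ x.1 v.1
  have b := metricAt_nonneg g₂ x.2 v.2
  have b' : 0 ≤ f x.1 ^ 2 * metricAt g₂ x.2 v.2 v.2 := by positivity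
  exact ⟨by simp only [mem_ofPred_eq]; linarith, by simp only [mem_ofPred_eq]; linarith⟩

set_option synthInstance.maxHeartbeats 200000 in
theorem warpedForm_contMDiff (g₁ : SmoothMetric I₁ N₁) (g₂ : SmoothMetric I₂ N₂) (f : N₁ → ℝ)
    (hf : ContMDiff I₁ 𝓘(ℝ, ℝ) ∞ f) :
    ContMDiff (I₁.prod I₂) ((I₁.prod I₂).prod 𝓘(ℝ, E₁ × E₂ →L[ℝ] E₁ × E₂ →L[ℝ] ℝ)) ∞
      (fun b ↦ TotalSpace.mk' (E₁ × E₂ →L[ℝ] E₁ × E₂ →L[ℝ] ℝ)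
        (E := fun x : N₁ × N₂ => TangentSpace (I₁.prod I₂) x →L[ℝ]
          TangentSpace (I₁.prod I₂) x →L[ℝ] ℝ) b (warpedForm g₁ g₂ f b)) := by
  intro x₀
  refine (contMDiffAt_metric_iff (I := I₁.prod I₂) (warpedForm g₁ g₂ f) x₀).2 ?_
  have h₁ := ((contMDiffAt_metric_iff g₁.inner x₀.1).1 (g₁.contMDiff x₀.1)).comp x₀
    (contMDiffAt_fst (I := I₁) (J := I₂))
  have h₂ := ((contMDiffAt_metric_iff g₂.inner x₀.2).1 (g₂.contMDiff x₀.2)).comp x₀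
    (contMDiffAt_snd (I := I₁) (J := I₂))
  have h₃ := (hf x₀.1).comp x₀ (contMDiffAt_fst (I := I₁) (J := I₂))
  refine (contMDiffAt_combination h₁ h₂ h₃ (pullbackForm (ContinuousLinearMap.fst ℝ E₁ E₂))
    (pullbackForm (ContinuousLinearMap.snd ℝ E₁ E₂))).congr_of_eventuallyEq ?_
  filter_upwards [continuousAt_fst.preimage_mem_nhds (chart_source_mem_nhds H₁ x₀.1),
    continuousAt_snd.preimage_mem_nhds (chart_source_mem_nhds H₂ x₀.2)] with b hb₁ hb₂
  rw [tangentCoordChange_prod x₀ b hb₁ hb₂]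
  rfl

/-- The warped product metric `g₁ + f² g₂` on `N₁ × N₂`. -/
def warpedMetric (g₁ : SmoothMetric I₁ N₁) (g₂ : SmoothMetric I₂ N₂) (f : N₁ → ℝ)
    (hf : ContMDiff I₁ 𝓘(ℝ, ℝ) ∞ f) (hpos : ∀ p, 0 < f p) :
    SmoothMetric (I₁.prod I₂) (N₁ × N₂) where
  inner x := warpedForm g₁ g₂ f x
  symm x _ _ := congrArg₂ (fun a b => a + f x.1 ^ 2 * b) (g₁.symm x.1 _ _) (g₂.symm x.2 _ _)
  pos x v hv := warpedForm_pos g₁ g₂ f hpos x v hv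
  isVonNBounded x :=
    (NormedSpace.isVonNBounded_iff ℝ (E := E₁ × E₂)).2 (warpedForm_isBounded g₁ g₂ f hpos x)
  contMDiff := warpedForm_contMDiff g₁ g₂ f hf

end Warped

end WarpedChen

end

noncomputable section

namespace WarpedChen

open Filter Topology

section LocalGauss

variable {E : Type*} [NormedAddCommGroup E] [NormedSpace ℝ E]
  {E' : Type*} [NormedAddCommGroup E'] [NormedSpace ℝ E']
  {W : Type*} [NormedAddCommGroup W] [NormedSpace ℝ W]

instance instNormedAddCommGroupBilin : NormedAddCommGroup (E →L[ℝ] E →L[ℝ] W) :=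
  ContinuousLinearMap.toNormedAddCommGroup

instance instNormedSpaceBilin : NormedSpace ℝ (E →L[ℝ] E →L[ℝ] W) :=
  ContinuousLinearMap.toNormedSpace

/-- Product rule for a bilinear form depending on the point. -/
theorem fderiv_bilin_apply {B : E → E' →L[ℝ] E' →L[ℝ] W} {a b : E → E'} {p : E}
    (hB : DifferentiableAt ℝ B p) (ha : DifferentiableAt ℝ a p) (hb : DifferentiableAt ℝ b p)
    (u : E) :
    fderiv ℝ (fun q => B q (a q) (b q)) p u =
      fderiv ℝ B p u (a p) (b p) + B p (fderiv ℝ a p u) (b p) + B p (a p) (fderiv ℝ b p u) := by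
  rw [((hB.hasFDerivAt.clm_apply ha.hasFDerivAt).clm_apply hb.hasFDerivAt).fderiv]
  simp
  abel

/-- `G` is a nondegenerate symmetric tensor of class `C²` near `p`. -/
structure IsMetricNear (G : E → E →L[ℝ] E →L[ℝ] ℝ) (p : E) : Prop where
  contDiffAt : ContDiffAt ℝ 2 G p
  symm : ∀ᶠ q in 𝓝 p, ∀ u v, G q u v = G q v u
  invertible : ∀ᶠ q in 𝓝 p, (G q).IsInvertible

theorem IsMetricNear.eventually {G : E → E →L[ℝ] E →L[ℝ] ℝ} {p : E} (h : IsMetricNear G p) :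
    ∀ᶠ q in 𝓝 p, IsMetricNear G q := by
  filter_upwards [h.contDiffAt.eventually (by simp), h.symm.eventually_nhds,
    h.invertible.eventually_nhds] with q h₁ h₂ h₃ using ⟨h₁, h₂, h₃⟩

variable {G : E → E →L[ℝ] E →L[ℝ] ℝ} {p : E}

theorem christoffelFirst_apply (u v w : E) :
    christoffelFirst G p u v w =
      1 / 2 * (fderiv ℝ G p u v w + fderiv ℝ G p v u w - fderiv ℝ G p w u v) := by
  simp [christoffelFirst]

/-- The Christoffel symbol as a continuous bilinear map. -/
def christoffelL [FiniteDimensional ℝ E] (G : E → E →L[ℝ] E →L[ℝ] ℝ) (p : E) : E →L[ℝ] E →L[ℝ] E :=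
  (LinearMap.toContinuousLinearMap.toLinearMap.comp (LinearMap.mk₂ ℝ (christoffel G p)
    (fun u u' v => by
      rw [christoffel, christoffel, christoffel, ← map_add]
      congr 1
      ext w
      simp only [christoffelFirst_apply, add_apply, map_add]
      ring)
    (fun c u v => by
      rw [christoffel, christoffel, ← map_smul]
      congr 1
      ext w
      simp only [christoffelFirst_apply, smul_apply, map_smul, smul_eq_mul]
      ring)
    (fun u v v' => by
      rw [christoffel, christoffel, christoffel, ← map_add]
      congr 1
      ext w
      simp only [christoffelFirst_apply, add_apply, map_add]
      ring)
    (fun c u v => by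
      rw [christoffel, christoffel, ← map_smul]
      congr 1
      ext w
      simp only [christoffelFirst_apply, smul_apply, map_smul, smul_eq_mul]
      ring))).toContinuousLinearMap

theorem christoffelL_apply [FiniteDimensional ℝ E] (u v : E) :
    christoffelL G p u v = christoffel G p u v := rfl

theorem IsMetricNear.metric_christoffel (h : IsMetricNear G p) (u v w : E) :
    G p (christoffel G p u v) w =
      1 / 2 * (fderiv ℝ G p u v w + fderiv ℝ G p v u w - fderiv ℝ G p w u v) := by
  rw [christoffel, h.invertible.self_of_nhds.self_apply_inverse, christoffelFirst_apply]

theorem IsMetricNear.ext_metric (h : IsMetricNear G p) {a b : E}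
    (hab : ∀ w, G p a w = G p b w) : a = b :=
  h.invertible.self_of_nhds.injective (ContinuousLinearMap.ext hab)

theorem IsMetricNear.differentiableAt (h : IsMetricNear G p) : DifferentiableAt ℝ G p :=
  h.contDiffAt.differentiableAt (by norm_num)

theorem IsMetricNear.fderiv_symm (h : IsMetricNear G p) (w u v : E) :
    fderiv ℝ G p w u v = fderiv ℝ G p w v u := by
  have e : (fun q => G q u v) =ᶠ[𝓝 p] fun q => G q v u := h.symm.mono fun q hq => hq u v
  have := congrArg (fun L : E →L[ℝ] ℝ => L w) e.fderiv_eq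
  simpa [fderiv_bilin_apply h.differentiableAt (differentiableAt_const _)
    (differentiableAt_const _)] using this

theorem IsMetricNear.christoffel_symm (h : IsMetricNear G p) (u v : E) :
    christoffel G p u v = christoffel G p v u := by
  refine h.ext_metric fun w => ?_
  rw [h.metric_christoffel, h.metric_christoffel, h.fderiv_symm w u v]
  ring

/-- The Levi-Civita connection is metric. -/
theorem IsMetricNear.fderiv_metric (h : IsMetricNear G p) (w u v : E) :
    fderiv ℝ G p w u v = G p (christoffel G p w u) v + G p u (christoffel G p w v) := by
  rw [h.symm.self_of_nhds u, h.metric_christoffel, h.metric_christoffel, h.fderiv_symm w v u,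
    h.fderiv_symm u w v, h.fderiv_symm v w u]
  ring

theorem contDiffAt_of_forall_clm_apply [FiniteDimensional ℝ E'] {n : ℕ∞ω} {f : E → E' →L[ℝ] W}
    (h : ∀ y, ContDiffAt ℝ n (fun q => f q y) p) : ContDiffAt ℝ n f p := by
  let d := Module.finrank ℝ E'
  have hd : d = Module.finrank ℝ (Fin d → ℝ) := (Module.finrank_fin_fun ℝ).symm
  let e₁ := ContinuousLinearEquiv.ofFinrankEq hd
  let e₂ := (e₁.arrowCongr (1 : W ≃L[ℝ] W)).trans (ContinuousLinearEquiv.piRing (Fin d))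
  rw [← Function.id_comp f, ← e₂.symm_comp_self]
  exact e₂.symm.contDiff.contDiffAt.comp p (contDiffAt_pi.2 fun i => h _)

theorem contDiffAt_fderiv_apply {F : E → W} (h : ContDiffAt ℝ 2 F p) (u : E) :
    ContDiffAt ℝ 1 (fun q => fderiv ℝ F q u) p :=
  (h.fderiv_right (m := 1) (by norm_num)).clm_apply contDiffAt_const

theorem IsMetricNear.contDiffAt_fderiv_apply (h : IsMetricNear G p) (u v w : E) :
    ContDiffAt ℝ 1 (fun q => fderiv ℝ G q u v w) p :=
  ((WarpedChen.contDiffAt_fderiv_apply (W := E →L[ℝ] E →L[ℝ] ℝ) h.contDiffAt u).clm_apply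
    contDiffAt_const).clm_apply contDiffAt_const

theorem IsMetricNear.contDiffAt_christoffel [FiniteDimensional ℝ E] (h : IsMetricNear G p)
    (u v : E) : ContDiffAt ℝ 1 (fun q => christoffel G q u v) p := by
  have : CompleteSpace E := FiniteDimensional.complete ℝ E
  have hi : ContDiffAt ℝ 1 (fun q => (G q).inverse) p :=
    (h.invertible.self_of_nhds.contDiffAt_map_inverse).comp p (h.contDiffAt.of_le (by norm_num))
  refine hi.clm_apply (contDiffAt_of_forall_clm_apply fun w => ?_)
  simp only [christoffelFirst_apply]
  exact contDiffAt_const.mul (((h.contDiffAt_fderiv_apply u v w).add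
    (h.contDiffAt_fderiv_apply v u w)).sub (h.contDiffAt_fderiv_apply w u v))

theorem IsMetricNear.contDiffAt_christoffelL [FiniteDimensional ℝ E] (h : IsMetricNear G p) :
    ContDiffAt ℝ 1 (christoffelL G) p :=
  contDiffAt_of_forall_clm_apply fun u => contDiffAt_of_forall_clm_apply fun v => h.contDiffAt_christoffel u v

/-- The chain rule in directional form. -/
theorem differentiableAt_comp_and_fderiv {B : E' → W} {F : E → E'}
    (hB : DifferentiableAt ℝ B (F p)) (hF : DifferentiableAt ℝ F p) :
    DifferentiableAt ℝ (fun q => B (F q)) p ∧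
      ∀ u, fderiv ℝ (fun q => B (F q)) p u = fderiv ℝ B (F p) (fderiv ℝ F p u) :=
  ⟨hB.comp p hF, fun u => congrArg (fun L => L u) (fderiv_comp p hB hF)⟩

/-- The second fundamental form of a map `F` between open sets of vector spaces. -/
def sffLocal (G : E → E →L[ℝ] E →L[ℝ] ℝ) (G' : E' → E' →L[ℝ] E' →L[ℝ] ℝ) (F : E → E')
    (p u v : E) : E' :=
  fderiv ℝ (fderiv ℝ F) p u v
    + christoffel G' (F p) (fderiv ℝ F p u) (fderiv ℝ F p v)
    - fderiv ℝ F p (christoffel G p u v)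

/-- `F` is an isometry near `p` from the metric `G` to the metric `G'`. -/
structure IsIsometryNear (G : E → E →L[ℝ] E →L[ℝ] ℝ) (G' : E' → E' →L[ℝ] E' →L[ℝ] ℝ) (F : E → E')
    (p : E) : Prop where
  source : IsMetricNear G p
  target : IsMetricNear G' (F p)
  contDiffAt : ContDiffAt ℝ 3 F p
  isometry : ∀ᶠ q in 𝓝 p, ∀ u v, G q u v = G' (F q) (fderiv ℝ F q u) (fderiv ℝ F q v)

variable {G' : E' → E' →L[ℝ] E' →L[ℝ] ℝ} {F : E → E'}

theorem IsIsometryNear.eventually (h : IsIsometryNear G G' F p) :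
    ∀ᶠ q in 𝓝 p, IsIsometryNear G G' F q := by
  filter_upwards [h.source.eventually,
    h.contDiffAt.continuousAt.eventually h.target.eventually,
    h.contDiffAt.eventually (by simp), h.isometry.eventually_nhds] with q h₁ h₂ h₃ h₄
    using ⟨h₁, h₂, h₃, h₄⟩

theorem ContDiffAt.fderiv_fderiv_symm {F : E → W} (h : ContDiffAt ℝ 2 F p) (u v : E) :
    fderiv ℝ (fderiv ℝ F) p u v = fderiv ℝ (fderiv ℝ F) p v u :=
  (h.isSymmSndFDerivAt (by simp)).eq u v

namespace IsIsometryNear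

variable (h : IsIsometryNear G G' F p)
include h

theorem differentiableAt : DifferentiableAt ℝ F p := h.contDiffAt.differentiableAt (by norm_num)

theorem contDiffAt_fderiv : ContDiffAt ℝ 2 (fderiv ℝ F) p :=
  h.contDiffAt.fderiv_right (by norm_num)

theorem differentiableAt_fderiv : DifferentiableAt ℝ (fderiv ℝ F) p :=
  h.contDiffAt_fderiv.differentiableAt (by norm_num)

theorem differentiableAt_fderiv_fderiv : DifferentiableAt ℝ (fderiv ℝ (fderiv ℝ F)) p :=
  (h.contDiffAt_fderiv.fderiv_right (m := 1) (by norm_num)).differentiableAt (by norm_num)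

theorem differentiableAt_fderiv_apply (v : E) : DifferentiableAt ℝ (fun q => fderiv ℝ F q v) p :=
  h.differentiableAt_fderiv.clm_apply (differentiableAt_const v)

theorem fderiv_fderiv_apply (u v : E) :
    fderiv ℝ (fun q => fderiv ℝ F q v) p u = fderiv ℝ (fderiv ℝ F) p u v := by
  rw [fderiv_clm_apply h.differentiableAt_fderiv (differentiableAt_const v)]
  simp

theorem fderiv_symm (u v : E) :
    fderiv ℝ (fderiv ℝ F) p u v = fderiv ℝ (fderiv ℝ F) p v u :=
  ContDiffAt.fderiv_fderiv_symm (h.contDiffAt.of_le (by norm_num)) u v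

theorem sffLocal_symm (u v : E) : sffLocal G G' F p u v = sffLocal G G' F p v u := by
  rw [sffLocal, sffLocal, h.fderiv_symm, h.target.christoffel_symm, h.source.christoffel_symm]

theorem fderiv_metric_comp (u : E) {a b : E → E'} (ha : DifferentiableAt ℝ a p)
    (hb : DifferentiableAt ℝ b p) :
    fderiv ℝ (fun q => G' (F q) (a q) (b q)) p u =
      G' (F p) (fderiv ℝ a p u + christoffel G' (F p) (fderiv ℝ F p u) (a p)) (b p) +
      G' (F p) (a p) (fderiv ℝ b p u + christoffel G' (F p) (fderiv ℝ F p u) (b p)) := by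
  obtain ⟨hc, hc'⟩ := differentiableAt_comp_and_fderiv (W := E' →L[ℝ] E' →L[ℝ] ℝ)
    h.target.differentiableAt h.differentiableAt
  rw [fderiv_bilin_apply hc ha hb, hc', h.target.fderiv_metric]
  simp only [map_add, add_apply]
  ring

theorem differentiableAt_christoffelL_comp [FiniteDimensional ℝ E'] :
    DifferentiableAt ℝ (fun q => christoffelL G' (F q)) p ∧
      ∀ u, fderiv ℝ (fun q => christoffelL G' (F q)) p u =
        fderiv ℝ (christoffelL G') (F p) (fderiv ℝ F p u) :=
  differentiableAt_comp_and_fderiv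
    (h.target.contDiffAt_christoffelL.differentiableAt (by norm_num)) h.differentiableAt

end IsIsometryNear

/-- The ambient covariant derivative of `DF w` along `F` in the direction `v`. -/
def secondDeriv (G' : E' → E' →L[ℝ] E' →L[ℝ] ℝ) (F : E → E') (v w p : E) : E' :=
  fderiv ℝ (fderiv ℝ F) p v w + christoffel G' (F p) (fderiv ℝ F p v) (fderiv ℝ F p w)

theorem secondDeriv_eq (v w : E) :
    secondDeriv G' F v w p = sffLocal G G' F p v w + fderiv ℝ F p (christoffel G p v w) := by
  simp [secondDeriv, sffLocal]

theorem IsMetricNear.fderiv_christoffel_apply [FiniteDimensional ℝ E] (h : IsMetricNear G p)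
    (u v w : E) :
    fderiv ℝ (fun q => christoffel G q v w) p u = fderiv ℝ (christoffelL G) p u v w := by
  have := fderiv_bilin_apply (h.contDiffAt_christoffelL.differentiableAt (by norm_num))
    (differentiableAt_const v) (differentiableAt_const w) u
  rw [fderiv_fun_const, fderiv_fun_const] at this
  simp only [Pi.zero_apply, zero_apply, map_zero, add_zero] at this
  exact this

namespace IsIsometryNear

variable (h : IsIsometryNear G G' F p)
include h

theorem secondDeriv_symm (v w : E) : secondDeriv G' F v w p = secondDeriv G' F w v p := by
  rw [secondDeriv, secondDeriv, h.fderiv_symm, h.target.christoffel_symm]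

theorem fderiv_source_metric (w u v : E) :
    fderiv ℝ G p w u v = G' (F p) (secondDeriv G' F w u p) (fderiv ℝ F p v) +
      G' (F p) (fderiv ℝ F p u) (secondDeriv G' F w v p) := by
  have e : (fun q => G q u v) =ᶠ[𝓝 p] fun q => G' (F q) (fderiv ℝ F q u) (fderiv ℝ F q v) :=
    h.isometry.mono fun q hq => hq u v
  have := congrArg (fun L : E →L[ℝ] ℝ => L w) e.fderiv_eq
  simp only [h.fderiv_metric_comp w (h.differentiableAt_fderiv_apply u)
    (h.differentiableAt_fderiv_apply v), h.fderiv_fderiv_apply] at this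
  rw [fderiv_bilin_apply h.source.differentiableAt (differentiableAt_const _)
    (differentiableAt_const _)] at this
  simpa [secondDeriv] using this

/-- The second fundamental form is normal. -/
theorem sffLocal_normal (u v w : E) :
    G' (F p) (sffLocal G G' F p u v) (fderiv ℝ F p w) = 0 := by
  have e := secondDeriv_eq (G := G) (G' := G') (F := F) (p := p) u v
  have k := h.source.metric_christoffel u v w
  rw [h.fderiv_source_metric, h.fderiv_source_metric, h.fderiv_source_metric,
    h.isometry.self_of_nhds] at k
  have s := h.target.symm.self_of_nhds
  rw [h.secondDeriv_symm v u, h.secondDeriv_symm w u, h.secondDeriv_symm w v,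
    s (secondDeriv G' F u w p), s (fderiv ℝ F p u)] at k
  have e' := congrArg (fun x => G' (F p) x (fderiv ℝ F p w)) e
  simp only [map_add, add_apply] at e'
  linarith

theorem metric_secondDeriv (u v w : E) :
    G' (F p) (secondDeriv G' F u v p) (fderiv ℝ F p w) = G p (christoffel G p u v) w := by
  rw [secondDeriv_eq (G := G), map_add, add_apply, h.sffLocal_normal, zero_add,
    h.isometry.self_of_nhds]

theorem metric_secondDeriv_secondDeriv (u v w z : E) :
    G' (F p) (secondDeriv G' F u v p) (secondDeriv G' F w z p) =
      G' (F p) (sffLocal G G' F p u v) (sffLocal G G' F p w z) +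
        G p (christoffel G p u v) (christoffel G p w z) := by
  rw [secondDeriv_eq (G := G), secondDeriv_eq (G := G)]
  simp only [map_add, add_apply, h.sffLocal_normal]
  rw [h.target.symm.self_of_nhds (fderiv ℝ F p _) (sffLocal _ _ _ _ w z), h.sffLocal_normal,
    h.isometry.self_of_nhds]
  ring

theorem differentiableAt_secondDeriv [FiniteDimensional ℝ E'] (v w : E) :
    DifferentiableAt ℝ (secondDeriv G' F v w) p :=
  ((h.differentiableAt_fderiv_fderiv.clm_apply (differentiableAt_const v)).clm_apply
    (differentiableAt_const w)).add ((h.differentiableAt_christoffelL_comp.1.clm_apply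
      (h.differentiableAt_fderiv_apply v)).clm_apply (h.differentiableAt_fderiv_apply w))

theorem fderiv_secondDeriv [FiniteDimensional ℝ E'] (u v w : E) :
    fderiv ℝ (secondDeriv G' F v w) p u =
      fderiv ℝ (fun q => fderiv ℝ (fderiv ℝ F) q v w) p u +
      (fderiv ℝ (christoffelL G') (F p) (fderiv ℝ F p u) (fderiv ℝ F p v) (fderiv ℝ F p w) +
        christoffelL G' (F p) (fderiv ℝ (fderiv ℝ F) p u v) (fderiv ℝ F p w) +
        christoffelL G' (F p) (fderiv ℝ F p v) (fderiv ℝ (fderiv ℝ F) p u w)) := by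
  have hd := (h.differentiableAt_fderiv_fderiv.clm_apply (differentiableAt_const v)).clm_apply
    (differentiableAt_const w)
  obtain ⟨hc, hc'⟩ := h.differentiableAt_christoffelL_comp
  have hv := h.differentiableAt_fderiv_apply v
  have hw := h.differentiableAt_fderiv_apply w
  have := fderiv_add hd ((hc.clm_apply hv).clm_apply hw)
  have e := congrArg (fun L : E →L[ℝ] E' => L u) this
  refine e.trans ?_
  rw [add_apply, fderiv_bilin_apply hc hv hw, hc', h.fderiv_fderiv_apply, h.fderiv_fderiv_apply]

theorem fderiv_fderiv_fderiv_symm (u v w : E) :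
    fderiv ℝ (fun q => fderiv ℝ (fderiv ℝ F) q v w) p u =
      fderiv ℝ (fun q => fderiv ℝ (fderiv ℝ F) q u w) p v := by
  have hw : ContDiffAt ℝ 2 (fun q => fderiv ℝ F q w) p :=
    h.contDiffAt_fderiv.clm_apply contDiffAt_const
  have key : ∀ a b : E, fderiv ℝ (fun q => fderiv ℝ (fderiv ℝ F) q a w) p b =
      fderiv ℝ (fderiv ℝ (fun q => fderiv ℝ F q w)) p b a := by
    intro a b
    have e : (fun q => fderiv ℝ (fderiv ℝ F) q a w) =ᶠ[𝓝 p]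
        fun q => fderiv ℝ (fun q => fderiv ℝ F q w) q a :=
      h.eventually.mono fun q hq => (hq.fderiv_fderiv_apply a w).symm
    rw [e.fderiv_eq, fderiv_clm_apply ((hw.fderiv_right (m := 1) (by norm_num)).differentiableAt
      (by norm_num)) (differentiableAt_const a)]
    simp
  rw [key, key, ContDiffAt.fderiv_fderiv_symm hw]

theorem curvatureLocal_target [FiniteDimensional ℝ E'] (u v w : E) :
    curvatureLocal G' (F p) (fderiv ℝ F p u) (fderiv ℝ F p v) (fderiv ℝ F p w) =
      (fderiv ℝ (secondDeriv G' F v w) p u +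
        christoffel G' (F p) (fderiv ℝ F p u) (secondDeriv G' F v w p)) -
      (fderiv ℝ (secondDeriv G' F u w) p v +
        christoffel G' (F p) (fderiv ℝ F p v) (secondDeriv G' F u w p)) := by
  rw [h.fderiv_secondDeriv, h.fderiv_secondDeriv, h.fderiv_fderiv_fderiv_symm v u,
    h.fderiv_symm v u, curvatureLocal, h.target.fderiv_christoffel_apply,
    h.target.fderiv_christoffel_apply]
  simp only [secondDeriv, ← christoffelL_apply, map_add]
  abel

variable [FiniteDimensional ℝ E]

theorem metric_covariant_secondDeriv [FiniteDimensional ℝ E'] (u v w z : E) :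
    G' (F p) (fderiv ℝ (secondDeriv G' F v w) p u +
        christoffel G' (F p) (fderiv ℝ F p u) (secondDeriv G' F v w p)) (fderiv ℝ F p z) =
      G p (fderiv ℝ (fun q => christoffel G q v w) p u +
        christoffel G p u (christoffel G p v w)) z -
      G' (F p) (sffLocal G G' F p v w) (sffLocal G G' F p u z) := by
  have e : (fun q => G' (F q) (secondDeriv G' F v w q) (fderiv ℝ F q z)) =ᶠ[𝓝 p]
      fun q => G q (christoffel G q v w) z :=
    h.eventually.mono fun q hq => hq.metric_secondDeriv v w z
  have k := congrArg (fun L : E →L[ℝ] ℝ => L u) e.fderiv_eq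
  simp only [h.fderiv_metric_comp u (h.differentiableAt_secondDeriv v w)
    (h.differentiableAt_fderiv_apply z), h.fderiv_fderiv_apply] at k
  rw [fderiv_bilin_apply h.source.differentiableAt
    ((h.source.contDiffAt_christoffel v w).differentiableAt (by norm_num))
    (differentiableAt_const _), h.source.fderiv_metric, fderiv_fun_const] at k
  have k' := h.metric_secondDeriv_secondDeriv v w u z
  rw [show secondDeriv G' F u z p = fderiv ℝ (fderiv ℝ F) p u z +
    christoffel G' (F p) (fderiv ℝ F p u) (fderiv ℝ F p z) from rfl] at k'
  simp only [map_add, add_apply, Pi.zero_apply, zero_apply, map_zero] at k k' ⊢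
  linarith

/-- The Gauss equation. -/
theorem gauss [FiniteDimensional ℝ E'] (u v w z : E) :
    G p (curvatureLocal G p u v w) z =
      G' (F p) (curvatureLocal G' (F p) (fderiv ℝ F p u) (fderiv ℝ F p v) (fderiv ℝ F p w))
        (fderiv ℝ F p z) +
      G' (F p) (sffLocal G G' F p v w) (sffLocal G G' F p u z) -
      G' (F p) (sffLocal G G' F p u w) (sffLocal G G' F p v z) := by
  rw [h.curvatureLocal_target, map_sub, sub_apply, h.metric_covariant_secondDeriv,
    h.metric_covariant_secondDeriv, curvatureLocal]
  simp only [map_add, map_sub, add_apply, sub_apply]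
  ring

end IsIsometryNear

end LocalGauss

section LocalWarped

variable {E₁ : Type*} [NormedAddCommGroup E₁] [NormedSpace ℝ E₁]
  {E₂ : Type*} [NormedAddCommGroup E₂] [NormedSpace ℝ E₂]

/-- Near `p`, the metric `G` is the warped product of `G₁` and `G₂` with warping function `ψ`. -/
structure IsWarpedNear (G : E₁ × E₂ → E₁ × E₂ →L[ℝ] E₁ × E₂ →L[ℝ] ℝ)
    (G₁ : E₁ → E₁ →L[ℝ] E₁ →L[ℝ] ℝ) (G₂ : E₂ → E₂ →L[ℝ] E₂ →L[ℝ] ℝ) (ψ : E₁ → ℝ)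
    (p : E₁ × E₂) : Prop where
  total : IsMetricNear G p
  base : IsMetricNear G₁ p.1
  fiber : IsMetricNear G₂ p.2
  contDiffAt : ContDiffAt ℝ 2 ψ p.1
  ne_zero : ψ p.1 ≠ 0
  eq : ∀ᶠ q in 𝓝 p, ∀ u v, G q u v = G₁ q.1 u.1 v.1 + ψ q.1 ^ 2 * G₂ q.2 u.2 v.2

variable {G : E₁ × E₂ → E₁ × E₂ →L[ℝ] E₁ × E₂ →L[ℝ] ℝ} {G₁ : E₁ → E₁ →L[ℝ] E₁ →L[ℝ] ℝ}
  {G₂ : E₂ → E₂ →L[ℝ] E₂ →L[ℝ] ℝ} {ψ : E₁ → ℝ} {p : E₁ × E₂}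

theorem fderiv_prodMk_left_apply (q X : E₁) (p₂ : E₂) : fderiv ℝ (fun q => (q, p₂)) q X = (X, 0) := by
  rw [(hasFDerivAt_prodMk_left q p₂).fderiv]
  simp

namespace IsWarpedNear

variable (h : IsWarpedNear G G₁ G₂ ψ p)
include h

theorem eventually : ∀ᶠ q in 𝓝 p, IsWarpedNear G G₁ G₂ ψ q := by
  have hc : ContinuousAt (fun q : E₁ × E₂ => ψ q.1) p :=
    h.contDiffAt.continuousAt.comp continuousAt_fst
  filter_upwards [h.total.eventually, continuousAt_fst.eventually h.base.eventually,
    continuousAt_snd.eventually h.fiber.eventually,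
    continuousAt_fst.eventually (h.contDiffAt.eventually (by simp)),
    hc.eventually_ne h.ne_zero, h.eq.eventually_nhds] with q h₁ h₂ h₃ h₄ h₅ h₆
    using ⟨h₁, h₂, h₃, h₄, h₅, h₆⟩

theorem differentiableAt : DifferentiableAt ℝ ψ p.1 := h.contDiffAt.differentiableAt (by norm_num)

theorem fderiv_total (w u v : E₁ × E₂) :
    fderiv ℝ G p w u v = fderiv ℝ G₁ p.1 w.1 u.1 v.1 +
      (2 * ψ p.1 * fderiv ℝ ψ p.1 w.1 * G₂ p.2 u.2 v.2 +
        ψ p.1 ^ 2 * fderiv ℝ G₂ p.2 w.2 u.2 v.2) := by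
  have e : (fun q => G q u v) =ᶠ[𝓝 p]
      fun q => G₁ q.1 u.1 v.1 + ψ q.1 ^ 2 * G₂ q.2 u.2 v.2 := h.eq.mono fun q hq => hq u v
  have k := congrArg (fun L : E₁ × E₂ →L[ℝ] ℝ => L w) e.fderiv_eq
  simp only [fderiv_bilin_apply h.total.differentiableAt (differentiableAt_const _)
    (differentiableAt_const _), fderiv_fun_const, Pi.zero_apply, zero_apply, map_zero,
    add_zero] at k
  rw [k]
  have h₁ : HasFDerivAt (fun q : E₁ × E₂ => G₁ q.1 u.1 v.1) _ p :=
    ((h.base.differentiableAt.hasFDerivAt.clm_apply (hasFDerivAt_const u.1 _)).clm_apply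
      (hasFDerivAt_const v.1 _)).comp p hasFDerivAt_fst
  have h₂ : HasFDerivAt (fun q : E₁ × E₂ => G₂ q.2 u.2 v.2) _ p :=
    ((h.fiber.differentiableAt.hasFDerivAt.clm_apply (hasFDerivAt_const u.2 _)).clm_apply
      (hasFDerivAt_const v.2 _)).comp p hasFDerivAt_snd
  have h₃ : HasFDerivAt (fun q : E₁ × E₂ => ψ q.1) _ p :=
    h.differentiableAt.hasFDerivAt.comp p hasFDerivAt_fst
  have h₄ : HasFDerivAt (fun q : E₁ × E₂ => G₁ q.1 u.1 v.1 + ψ q.1 ^ 2 * G₂ q.2 u.2 v.2) _ p :=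
    h₁.add ((h₃.pow 2).mul h₂)
  rw [h₄.fderiv]
  simp
  ring

theorem christoffel_base_base (X Y : E₁) :
    christoffel G p (X, 0) (Y, 0) = (christoffel G₁ p.1 X Y, 0) := by
  refine h.total.ext_metric fun w => ?_
  rw [h.total.metric_christoffel, h.fderiv_total, h.fderiv_total, h.fderiv_total,
    h.eq.self_of_nhds]
  simp only [map_zero, zero_apply, mul_zero, add_zero]
  rw [h.base.metric_christoffel]

theorem christoffel_fiber_base (V : E₂) (X : E₁) :
    christoffel G p (0, V) (X, 0) = (0, (fderiv ℝ ψ p.1 X / ψ p.1) • V) := by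
  refine h.total.ext_metric fun w => ?_
  rw [h.total.metric_christoffel, h.fderiv_total, h.fderiv_total, h.fderiv_total,
    h.eq.self_of_nhds]
  have := h.ne_zero
  simp only [map_zero, zero_apply, mul_zero, add_zero, map_smul, smul_apply, smul_eq_mul]
  field_simp
  ring

theorem curvature_fiber_base [FiniteDimensional ℝ E₁] (V : E₂) (X : E₁) :
    curvatureLocal G p (0, V) (X, 0) (X, 0) =
      (0, ((fderiv ℝ ψ p.1 (christoffel G₁ p.1 X X) - fderiv ℝ (fderiv ℝ ψ) p.1 X X) / ψ p.1) •
        V) := by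
  have e₁ : (fun q => christoffel G q (X, 0) (X, 0)) =ᶠ[𝓝 p]
      fun q => (christoffel G₁ q.1 X X, 0) :=
    h.eventually.mono fun q hq => hq.christoffel_base_base X X
  have e₂ : (fun q => christoffel G q (0, V) (X, 0)) =ᶠ[𝓝 p]
      fun q => (0, (fderiv ℝ ψ q.1 X * (ψ q.1)⁻¹) • V) :=
    h.eventually.mono fun q hq => by
      simp only [hq.christoffel_fiber_base V X, div_eq_mul_inv]
  have h₁ : HasFDerivAt (fun q : E₁ × E₂ => (christoffel G₁ q.1 X X, (0 : E₂))) _ p :=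
    ((((h.base.contDiffAt_christoffel X X).differentiableAt (by norm_num)).hasFDerivAt).comp p
      hasFDerivAt_fst).prodMk (hasFDerivAt_const _ _)
  have hψ : DifferentiableAt ℝ (fderiv ℝ ψ) p.1 :=
    (h.contDiffAt.fderiv_right (m := 1) (by norm_num)).differentiableAt (by norm_num)
  have h₂ : HasFDerivAt (fun q : E₁ × E₂ => ((0 : E₁), (fderiv ℝ ψ q.1 X * (ψ q.1)⁻¹) • V)) _ p :=
    (hasFDerivAt_const _ _).prodMk ((((hψ.hasFDerivAt.clm_apply (hasFDerivAt_const X _)).mul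
      ((hasDerivAt_inv h.ne_zero).comp_hasFDerivAt p.1 h.differentiableAt.hasFDerivAt)).comp p
        hasFDerivAt_fst).smul_const V)
  rw [curvatureLocal, e₁.fderiv_eq, e₂.fderiv_eq, h₁.fderiv, h₂.fderiv, h.christoffel_base_base,
    h.christoffel_fiber_base, h.christoffel_fiber_base, h.total.christoffel_symm (X, 0),
    h.christoffel_fiber_base]
  have := h.ne_zero
  ext
  · simp
  · simp
    rw [smul_smul, ← neg_smul, ← add_smul, ← sub_smul]
    congr 1
    field_simp
    ring

theorem isIsometryNear_inclusion : IsIsometryNear G₁ G (fun q => (q, p.2)) p.1 where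
  source := h.base
  target := h.total
  contDiffAt := contDiffAt_id.prodMk contDiffAt_const
  isometry := by
    have hc : ContinuousAt (fun q : E₁ => (q, p.2)) p.1 := by fun_prop
    filter_upwards [hc.eventually h.eq] with q hq u v
    simp [hq, fderiv_prodMk_left_apply]

/-- The slices `E₁ × {p₂}` are totally geodesic. -/
theorem sffLocal_inclusion (X Y : E₁) : sffLocal G₁ G (fun q => (q, p.2)) p.1 X Y = 0 := by
  have e : fderiv ℝ (fun q : E₁ => (q, p.2)) = fun _ => ContinuousLinearMap.inl ℝ E₁ E₂ :=
    funext fun q => ContinuousLinearMap.ext fun X => fderiv_prodMk_left_apply q X p.2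
  rw [sffLocal, fderiv_prodMk_left_apply, fderiv_prodMk_left_apply, fderiv_prodMk_left_apply,
    h.christoffel_base_base, e]
  simp

theorem curvature_base [FiniteDimensional ℝ E₁] [FiniteDimensional ℝ E₂] (X Y : E₁) :
    G p (curvatureLocal G p (X, 0) (Y, 0) (Y, 0)) (X, 0) =
      G₁ p.1 (curvatureLocal G₁ p.1 X Y Y) X := by
  have := h.isIsometryNear_inclusion.gauss X Y Y X
  simp only [h.sffLocal_inclusion, fderiv_prodMk_left_apply, map_zero, add_zero, sub_zero] at this
  exact this.symm

end IsWarpedNear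

end LocalWarped

section Chart

variable {E : Type*} [NormedAddCommGroup E] [NormedSpace ℝ E] {H : Type*} [TopologicalSpace H]
  {I : ModelWithCorners ℝ E H} {M : Type*} [TopologicalSpace M] [ChartedSpace H M]
  [IsManifold I ∞ M]

instance isManifold_one_of_infty : IsManifold I 1 M := .of_le (m := 1) (n := ∞) (by norm_num)

theorem mfderiv_extChartAt_symm [I.Boundaryless] {x : M} {p : E} (hp : p ∈ (extChartAt I x).target) :
    (mfderiv 𝓘(ℝ, E) I (extChartAt I x).symm p : E →L[ℝ] E) =
      tangentCoordChange I x ((extChartAt I x).symm p) ((extChartAt I x).symm p) := by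
  have hd : MDifferentiableAt 𝓘(ℝ, E) I (extChartAt I x).symm p :=
    ((mdifferentiableOn_extChartAt_symm (I := I) (x := x)) p hp).mdifferentiableAt
      ((isOpen_extChartAt_target x).mem_nhds hp)
  rw [tangentCoordChange_def, (extChartAt I x).right_inv hp, I.range_eq_univ]
  rw [mfderiv]
  refine (if_pos hd).trans ?_
  simp [writtenInExtChartAt, Function.comp_def, chartAt_self_eq]
  rfl

theorem metricInChart_eq [I.Boundaryless] (g : SmoothMetric I M) {x : M} {p : E}
    (hp : p ∈ (extChartAt I x).target) :
    metricInChart g x p = (metricAt g ((extChartAt I x).symm p)).bilinearComp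
      (tangentCoordChange I x ((extChartAt I x).symm p) ((extChartAt I x).symm p))
      (tangentCoordChange I x ((extChartAt I x).symm p) ((extChartAt I x).symm p)) := by
  rw [metricInChart, mfderiv_extChartAt_symm hp]

theorem metricInChart_self [I.Boundaryless] (g : SmoothMetric I M) (x : M) :
    metricInChart g x (extChartAt I x x) = metricAt g x := by
  rw [metricInChart_eq g (mem_extChartAt_target x), extChartAt_to_inv]
  ext u v
  simp only [ContinuousLinearMap.bilinearComp_apply]
  rw [tangentCoordChange_self (mem_extChartAt_source x),
    tangentCoordChange_self (mem_extChartAt_source x)]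

theorem contDiffAt_metricInChart [I.Boundaryless] (g : SmoothMetric I M) (x : M) :
    ContDiffAt ℝ ∞ (metricInChart g x) (extChartAt I x x) := by
  have h₁ := (contMDiffAt_metric_iff g.inner x).1 (g.contMDiff x)
  have h₂ : ContMDiffAt 𝓘(ℝ, E) I ∞ (extChartAt I x).symm (extChartAt I x x) :=
    (contMDiffOn_extChartAt_symm x).contMDiffAt (extChartAt_target_mem_nhds x)
  have h₃ := ContMDiffAt.comp_of_eq h₁ h₂ (extChartAt_to_inv x)
  refine h₃.contDiffAt.congr_of_eventuallyEq ?_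
  filter_upwards [extChartAt_target_mem_nhds (I := I) x] with p hp
  exact metricInChart_eq g hp

theorem metricAt_symm (g : SmoothMetric I M) (x : M) (u v : E) :
    metricAt g x u v = metricAt g x v u :=
  g.symm x u v

theorem metricAt_pos (g : SmoothMetric I M) (x : M) {v : E} (hv : v ≠ 0) : 0 < metricAt g x v v :=
  g.pos x v hv

theorem metricInChart_symm (g : SmoothMetric I M) (x : M) (p u v : E) :
    metricInChart g x p u v = metricInChart g x p v u :=
  metricAt_symm g ((extChartAt I x).symm p) _ _

theorem metricInChart_pos [I.Boundaryless] (g : SmoothMetric I M) {x : M} {p : E}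
    (hp : p ∈ (extChartAt I x).target) {v : E} (hv : v ≠ 0) : 0 < metricInChart g x p v v := by
  refine metricAt_pos g ((extChartAt I x).symm p) fun h => hv ?_
  have := isInvertible_mfderivWithin_extChartAt_symm hp
  rw [I.range_eq_univ, mfderivWithin_univ] at this
  exact this.injective (h.trans (map_zero _).symm)

theorem isInvertible_of_pos [FiniteDimensional ℝ E] {B : E →L[ℝ] E →L[ℝ] ℝ}
    (h : ∀ v, v ≠ 0 → 0 < B v v) : B.IsInvertible := by
  have hi : Function.Injective B := by
    refine (injective_iff_map_eq_zero B).2 fun v hv => by_contra fun hne => ?_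
    have := h v hne
    simp [hv] at this
  have hd : Module.finrank ℝ E = Module.finrank ℝ (E →L[ℝ] ℝ) := by
    rw [← Subspace.dual_finrank_eq]
    exact LinearMap.toContinuousLinearMap.finrank_eq
  exact ⟨(LinearEquiv.ofInjectiveOfFinrankEq B.toLinearMap hi hd).toContinuousLinearEquiv, rfl⟩

theorem isMetricNear_metricInChart [I.Boundaryless] [FiniteDimensional ℝ E] (g : SmoothMetric I M)
    (x : M) : IsMetricNear (metricInChart g x) (extChartAt I x x) where
  contDiffAt := (contDiffAt_metricInChart g x).of_le (by norm_cast)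
  symm := .of_forall fun q u v => metricInChart_symm g x q u v
  invertible := by
    filter_upwards [extChartAt_target_mem_nhds (I := I) x] with p hp
    exact isInvertible_of_pos fun v hv => metricInChart_pos g hp hv

variable {E' : Type*} [NormedAddCommGroup E'] [NormedSpace ℝ E'] {H' : Type*} [TopologicalSpace H']
  {I' : ModelWithCorners ℝ E' H'} {M' : Type*} [TopologicalSpace M'] [ChartedSpace H' M']
  [IsManifold I' ∞ M']

omit [IsManifold I ∞ M] [IsManifold I' ∞ M'] in
theorem writtenInExtChartAt_self (φ : M → M') (x : M) :
    writtenInExtChartAt I I' x φ (extChartAt I x x) = extChartAt I' (φ x) (φ x) := by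
  simp [writtenInExtChartAt]

omit [IsManifold I ∞ M] [IsManifold I' ∞ M'] in
theorem contDiffAt_writtenInExtChartAt [I.Boundaryless] {φ : M → M'} (hφ : ContMDiff I I' ∞ φ)
    (x : M) : ContDiffAt ℝ ∞ (writtenInExtChartAt I I' x φ) (extChartAt I x x) := by
  have := (contMDiffAt_iff.1 (hφ x)).2
  rw [I.range_eq_univ, contDiffWithinAt_univ] at this
  exact this

theorem isIsometryNear_writtenInExtChartAt [I.Boundaryless] [I'.Boundaryless]
    [FiniteDimensional ℝ E] [FiniteDimensional ℝ E'] {g : SmoothMetric I M}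
    {g' : SmoothMetric I' M'} {φ : M → M'} (hφ : IsIsometricImmersion g g' φ) (x : M) :
    IsIsometryNear (metricInChart g x) (metricInChart g' (φ x)) (writtenInExtChartAt I I' x φ)
      (extChartAt I x x) where
  source := isMetricNear_metricInChart g x
  target := by
    rw [writtenInExtChartAt_self]
    exact isMetricNear_metricInChart g' (φ x)
  contDiffAt := (contDiffAt_writtenInExtChartAt hφ.1 x).of_le (by norm_cast)
  isometry := by
    have hF := (contDiffAt_writtenInExtChartAt hφ.1 x).of_le (m := 1) (by norm_cast)
    have hc : ContinuousAt (fun p => φ ((extChartAt I x).symm p)) (extChartAt I x x) :=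
      (hφ.1.continuous.continuousAt).comp (continuousAt_extChartAt_symm x)
    have hs : ∀ᶠ p in 𝓝 (extChartAt I x x),
        φ ((extChartAt I x).symm p) ∈ (extChartAt I' (φ x)).source := by
      refine hc.eventually_mem ?_
      rw [extChartAt_to_inv]
      exact extChartAt_source_mem_nhds (φ x)
    filter_upwards [extChartAt_target_mem_nhds (I := I) x, hs.eventually_nhds,
      hF.eventually (by simp)] with p hp hsp hFp u v
    set F := writtenInExtChartAt I I' x φ with hFdef
    have hp' : F p ∈ (extChartAt I' (φ x)).target :=
      (extChartAt I' (φ x)).map_source hsp.self_of_nhds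
    have hback : (extChartAt I' (φ x)).symm (F p) = φ ((extChartAt I x).symm p) :=
      (extChartAt I' (φ x)).left_inv hsp.self_of_nhds
    have d₁ : MDifferentiableAt 𝓘(ℝ, E) I (extChartAt I x).symm p :=
      ((mdifferentiableOn_extChartAt_symm (I := I) (x := x)) p hp).mdifferentiableAt
        ((isOpen_extChartAt_target x).mem_nhds hp)
    have d₂ : MDifferentiableAt 𝓘(ℝ, E') I' (extChartAt I' (φ x)).symm (F p) :=
      ((mdifferentiableOn_extChartAt_symm (I := I') (x := φ x)) _ hp').mdifferentiableAt
        ((isOpen_extChartAt_target _).mem_nhds hp')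
    have d₃ : MDifferentiableAt 𝓘(ℝ, E) 𝓘(ℝ, E') F p :=
      (hFp.differentiableAt (by norm_num)).mdifferentiableAt
    have e : φ ∘ (extChartAt I x).symm =ᶠ[𝓝 p] (extChartAt I' (φ x)).symm ∘ F :=
      hsp.mono fun q hq => ((extChartAt I' (φ x)).left_inv hq).symm
    have k := e.mfderiv_eq (I := 𝓘(ℝ, E)) (I' := I')
    rw [mfderiv_comp p (hφ.1.mdifferentiable (by simp) _) d₁, mfderiv_comp p d₂ d₃] at k
    have key : ∀ w : E, (mfderiv I I' φ ((extChartAt I x).symm p) : E →L[ℝ] E')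
        ((mfderiv 𝓘(ℝ, E) I (extChartAt I x).symm p : E →L[ℝ] E) w) =
        (mfderiv 𝓘(ℝ, E') I' (extChartAt I' (φ x)).symm (F p) : E' →L[ℝ] E') (fderiv ℝ F p w) := by
      intro w
      rw [← mfderiv_eq_fderiv]
      exact congrArg (fun L : E →L[ℝ] E' => L w) k
    have hm : metricAt g' ((extChartAt I' (φ x)).symm (F p)) =
        metricAt g' (φ ((extChartAt I x).symm p)) := by rw [hback]
    calc metricInChart g x p u v
        = metricAt g ((extChartAt I x).symm p)
            ((mfderiv 𝓘(ℝ, E) I (extChartAt I x).symm p : E →L[ℝ] E) u)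
            ((mfderiv 𝓘(ℝ, E) I (extChartAt I x).symm p : E →L[ℝ] E) v) := rfl
      _ = metricAt g' (φ ((extChartAt I x).symm p)) _ _ := (hφ.2 ((extChartAt I x).symm p) _ _).symm
      _ = metricAt g' ((extChartAt I' (φ x)).symm (F p)) _ _ :=
        (congrArg₂ (fun a b => metricAt g' (φ ((extChartAt I x).symm p)) a b) (key u) (key v)).trans
          (by rw [hm]; rfl)

end Chart

section WarpedChart

variable {E₁ : Type*} [NormedAddCommGroup E₁] [NormedSpace ℝ E₁] {H₁ : Type*} [TopologicalSpace H₁]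
  {I₁ : ModelWithCorners ℝ E₁ H₁} {N₁ : Type*} [TopologicalSpace N₁] [ChartedSpace H₁ N₁]
  [IsManifold I₁ ∞ N₁]
  {E₂ : Type*} [NormedAddCommGroup E₂] [NormedSpace ℝ E₂] {H₂ : Type*} [TopologicalSpace H₂]
  {I₂ : ModelWithCorners ℝ E₂ H₂} {N₂ : Type*} [TopologicalSpace N₂] [ChartedSpace H₂ N₂]
  [IsManifold I₂ ∞ N₂] [I₁.Boundaryless] [I₂.Boundaryless]

theorem isWarpedNear_metricInChart [FiniteDimensional ℝ E₁] [FiniteDimensional ℝ E₂]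
    (g₁ : SmoothMetric I₁ N₁) (g₂ : SmoothMetric I₂ N₂)
    (f : N₁ → ℝ) (hf : ContMDiff I₁ 𝓘(ℝ, ℝ) ∞ f) (hpos : ∀ p, 0 < f p) (x : N₁ × N₂) :
    IsWarpedNear (metricInChart (warpedMetric g₁ g₂ f hf hpos) x) (metricInChart g₁ x.1)
      (metricInChart g₂ x.2) (f ∘ (extChartAt I₁ x.1).symm) (extChartAt (I₁.prod I₂) x x) where
  total := isMetricNear_metricInChart _ x
  base := isMetricNear_metricInChart g₁ x.1
  fiber := isMetricNear_metricInChart g₂ x.2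
  contDiffAt := by
    have h : ContMDiffAt 𝓘(ℝ, E₁) I₁ ∞ (extChartAt I₁ x.1).symm (extChartAt I₁ x.1 x.1) :=
      (contMDiffOn_extChartAt_symm x.1).contMDiffAt (extChartAt_target_mem_nhds x.1)
    exact ((hf _).comp _ h).contDiffAt.of_le (by norm_cast)
  ne_zero := (hpos _).ne'
  eq := by
    filter_upwards [extChartAt_target_mem_nhds (I := I₁.prod I₂) x] with p hp u v
    have hp' := hp
    rw [extChartAt_prod, PartialEquiv.prod_target] at hp'
    have hs : (extChartAt (I₁.prod I₂) x).symm p =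
        ((extChartAt I₁ x.1).symm p.1, (extChartAt I₂ x.2).symm p.2) := by
      rw [extChartAt_prod]
      rfl
    rw [metricInChart_eq _ hp, metricInChart_eq _ hp'.1, metricInChart_eq _ hp'.2, hs,
      tangentCoordChange_prod x _
        (by simpa using (extChartAt I₁ x.1).map_target hp'.1)
        (by simpa using (extChartAt I₂ x.2).map_target hp'.2)]
    rfl

end WarpedChart

section Frames

variable {E : Type*} [NormedAddCommGroup E] [NormedSpace ℝ E]
  {W : Type*} [AddCommGroup W] [Module ℝ W]
  {ι κ : Type*} [Fintype ι] [DecidableEq ι] [Fintype κ] [DecidableEq κ]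
  {B : E →L[ℝ] E →L[ℝ] ℝ} {e : ι → E} {e' : κ → E}

theorem linearIndependent_of_orthonormal (he : ∀ i j, B (e i) (e j) = if i = j then 1 else 0) :
    LinearIndependent ℝ e := by
  refine Fintype.linearIndependent_iff.2 fun a ha i => ?_
  have := congrArg (fun v => B v (e i)) ha
  simpa [map_sum, sum_apply, he] using this

theorem sum_smul_of_orthonormal [FiniteDimensional ℝ E]
    (he : ∀ i j, B (e i) (e j) = if i = j then 1 else 0)
    (hι : Fintype.card ι = Module.finrank ℝ E) (v : E) : ∑ i, B v (e i) • e i = v := by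
  have hv : v ∈ Submodule.span ℝ (range e) := by
    rw [(linearIndependent_of_orthonormal he).span_eq_top_of_card_eq_finrank' hι]
    trivial
  obtain ⟨a, rfl⟩ := (Submodule.mem_span_range_iff_exists_fun ℝ).1 hv
  simp [map_sum, sum_apply, he]

/-- The trace of a bilinear map does not depend on the orthonormal frame. -/
theorem sum_diag_eq_of_orthonormal [FiniteDimensional ℝ E]
    (hs : ∀ u v, B u v = B v u)
    (he : ∀ i j, B (e i) (e j) = if i = j then 1 else 0)
    (hι : Fintype.card ι = Module.finrank ℝ E)
    (he' : ∀ i j, B (e' i) (e' j) = if i = j then 1 else 0)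
    (hκ : Fintype.card κ = Module.finrank ℝ E) (T : E →ₗ[ℝ] E →ₗ[ℝ] W) :
    ∑ i, T (e i) (e i) = ∑ k, T (e' k) (e' k) := by
  calc ∑ i, T (e i) (e i) = ∑ i, T (e i) (∑ k, B (e i) (e' k) • e' k) := by
        simp only [sum_smul_of_orthonormal he' hκ]
    _ = ∑ k, T (∑ i, B (e' k) (e i) • e i) (e' k) := by
        simp only [map_sum, map_smul, LinearMap.sum_apply, LinearMap.smul_apply]
        rw [Finset.sum_comm]
        simp only [hs]
    _ = ∑ k, T (e' k) (e' k) := by simp only [sum_smul_of_orthonormal he hι]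

/-- An orthonormal pair extends to an orthonormal frame. -/
theorem exists_frame_extending [FiniteDimensional ℝ E]
    (hs : ∀ u v, B u v = B v u) (hp : ∀ v, v ≠ 0 → 0 < B v v)
    {u v : E} (hu : B u u = 1) (hv : B v v = 1) (huv : B u v = 0)
    (i j : Fin (Module.finrank ℝ E)) (hij : i ≠ j) :
    ∃ e, IsOrthonormalFrame B e ∧ e i = u ∧ e j = v := by
  obtain ⟨b, hb⟩ := exists_isOrthonormalFrame B hs hp
  let n := Module.finrank ℝ E
  let L : EuclideanSpace ℝ (Fin n) →ₗ[ℝ] E :=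
    (Fintype.linearCombination ℝ b).comp (WithLp.linearEquiv 2 ℝ (Fin n → ℝ)).toLinearMap
  have hL : ∀ x y, B (L x) (L y) = inner ℝ x y := by
    intro x y
    simp [L, Fintype.linearCombination_apply, map_sum, sum_apply, PiLp.inner_apply,
      IsOrthonormalFrame] at hb ⊢
    simp [hb, mul_comm]
    rfl
  let c : E → EuclideanSpace ℝ (Fin n) := fun w => WithLp.toLp 2 fun i => B w (b i)
  have hc : ∀ w, L (c w) = w := fun w =>
    sum_smul_of_orthonormal hb (Fintype.card_fin _) w
  have hc' : ∀ w z, inner ℝ (c w) (c z) = B w z := fun w z => by rw [← hL, hc, hc]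
  let o : Fin n → EuclideanSpace ℝ (Fin n) := fun k => if k = i then c u else c v
  have ho : Orthonormal ℝ (({i, j} : Set (Fin n)).domRestrict o) := by
    rw [orthonormal_iff_ite]
    rintro ⟨k, hk⟩ ⟨l, hl⟩
    simp only [Subtype.mk.injEq]
    change inner ℝ (o k) (o l) = _
    rcases hk with rfl | rfl <;> rcases hl with rfl | rfl <;>
      simp only [o, if_true, hij, hij.symm, if_false, hc', hu, hv, huv, hs v u]
  obtain ⟨b', hb'⟩ := ho.exists_orthonormalBasis_extension_of_card_eq
    (by simp [n])
  refine ⟨fun k => L (b' k), fun k l => ?_, ?_, ?_⟩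
  · rw [hL, orthonormal_iff_ite.1 b'.orthonormal]
  · simp [hb' i (by simp), o, hc]
  · simp [hb' j (by simp), o, hc, hij.symm]

/-- The Gram-Schmidt process for two vectors. -/
theorem exists_orthonormal_pair (hp : ∀ v, v ≠ 0 → 0 < B v v)
    {u v : E} (h : LinearIndependent ℝ ![u, v]) :
    ∃ (w z : E) (a b d : ℝ), B w w = 1 ∧ B z z = 1 ∧ B w z = 0 ∧ a ≠ 0 ∧ d ≠ 0 ∧
      u = a • w ∧ v = b • w + d • z := by
  have hu : u ≠ 0 := h.ne_zero 0
  have ha := Real.sqrt_pos.2 (hp u hu)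
  have ha2 := Real.mul_self_sqrt (hp u hu).le
  set a := √(B u u)
  have hz : v - (B u v / B u u) • u ≠ 0 := by
    intro h0
    have := LinearIndependent.pair_iff.1 h (-(B u v / B u u)) 1 (by rw [← h0]; module)
    exact one_ne_zero this.2
  have hd := Real.sqrt_pos.2 (hp _ hz)
  have hd2 := Real.mul_self_sqrt (hp _ hz).le
  set z := v - (B u v / B u u) • u with hzdef
  set d := √(B z z)
  have huz : B u z = 0 := by
    have := (hp u hu).ne'
    simp only [hzdef, map_sub, map_smul, smul_eq_mul]
    field_simp
    ring
  refine ⟨a⁻¹ • u, d⁻¹ • z, a, B u v / B u u * a, d, ?_, ?_, ?_, ha.ne', hd.ne', ?_, ?_⟩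
  · simp only [map_smul, smul_apply, smul_eq_mul, ← ha2]
    field_simp
  · simp only [map_smul, smul_apply, smul_eq_mul, ← hd2]
    field_simp
  · simp [huz]
  · rw [smul_smul, mul_inv_cancel₀ ha.ne', one_smul]
  · rw [smul_smul, smul_smul, mul_assoc, mul_inv_cancel₀ ha.ne', mul_inv_cancel₀ hd.ne', hzdef]
    module

/-- The Cauchy-Schwarz inequality for a sum of vectors. -/
theorem form_sum_sum_le {σ : Type*} [Fintype σ] (hp : ∀ v, 0 ≤ B v v) (v : σ → E) :
    B (∑ i, v i) (∑ i, v i) ≤ Fintype.card σ * ∑ i, B (v i) (v i) := by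
  have h : 0 ≤ ∑ i, ∑ j, B (v i - v j) (v i - v j) :=
    Finset.sum_nonneg fun i _ => Finset.sum_nonneg fun j _ => hp _
  have e : ∑ i, ∑ j, B (v i - v j) (v i - v j) =
      2 * (Fintype.card σ * ∑ i, B (v i) (v i)) - 2 * B (∑ i, v i) (∑ i, v i) := by
    simp only [map_sub, sub_apply, Finset.sum_sub_distrib, map_sum, sum_apply, Finset.sum_const,
      Finset.card_univ, nsmul_eq_mul, ← Finset.mul_sum]
    rw [Finset.sum_comm (f := fun i j => B (v j) (v i))]
    ring
  linarith

/-- Chen's algebraic inequality, with a defect term that detects the equality case. -/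
theorem chen_algebraic (hs : ∀ u v, B u v = B v u) (hp : ∀ v, 0 ≤ B v v) (A : ι → ι → E)
    (hA : ∀ a b, A a b = A b a) (y : E) {i j : ι} (hij : i ≠ j) :
    1 / 2 * (B (∑ a, A a a) (∑ a, A a a) - ∑ a, ∑ b, B (A a b) (A a b)) -
        (B (A i i) (A j j) - B (A i j) (A i j)) + B (∑ a, A a a) y ≤
      1 / 2 * (1 - 1 / Fintype.card ι) * B (∑ a, A a a + y) (∑ a, A a a + y) := by
  have hsplit : ∀ F : ι → ℝ, ∑ a, F a = F i + F j + ∑ a ∈ {i, j}ᶜ, F a := fun F => by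
    rw [← Finset.sum_add_sum_compl {i, j} F, Finset.sum_pair hij]
  have hsplit' : ∀ F : ι → E, ∑ a, F a = F i + F j + ∑ a ∈ {i, j}ᶜ, F a := fun F => by
    rw [← Finset.sum_add_sum_compl {i, j} F, Finset.sum_pair hij]
  have hdiag : ∑ a, B (A a a) (A a a) + 2 * B (A i j) (A i j) ≤ ∑ a, ∑ b, B (A a b) (A a b) := by
    have h₁ : ∀ a b, 0 ≤ B (A a b) (A a b) := fun a b => hp _
    have hi : B (A i i) (A i i) + B (A i j) (A i j) ≤ ∑ b, B (A i b) (A i b) := by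
      rw [hsplit]
      have := Finset.sum_nonneg fun b (_ : b ∈ ({i, j}ᶜ : Finset ι)) => h₁ i b
      linarith
    have hj : B (A j j) (A j j) + B (A i j) (A i j) ≤ ∑ b, B (A j b) (A j b) := by
      rw [hsplit, hA j i]
      have := Finset.sum_nonneg fun b (_ : b ∈ ({i, j}ᶜ : Finset ι)) => h₁ j b
      linarith
    have hr : ∑ a ∈ {i, j}ᶜ, B (A a a) (A a a) ≤ ∑ a ∈ {i, j}ᶜ, ∑ b, B (A a b) (A a b) :=
      Finset.sum_le_sum fun a _ => Finset.single_le_sum (f := fun b => B (A a b) (A a b))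
        (fun b _ => h₁ a b) (Finset.mem_univ a)
    rw [hsplit, hsplit fun a => ∑ b, B (A a b) (A a b)]
    linarith
  let v : ι → E := fun a => if a = i then y else if a = j then A i i + A j j else A a a
  have hv : ∀ a ∈ ({i, j}ᶜ : Finset ι), v a = A a a := fun a ha => by
    simp only [Finset.mem_compl, Finset.mem_insert, Finset.mem_singleton, not_or] at ha
    simp [v, ha.1, ha.2]
  have hvi : v i = y := by simp [v]
  have hvj : v j = A i i + A j j := by simp [v, hij.symm]
  have hcs := form_sum_sum_le hp v
  have hsum : ∑ a, v a = ∑ a, A a a + y := by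
    rw [hsplit', hsplit' fun a => A a a, Finset.sum_congr rfl hv, hvi, hvj]
    abel
  have hsum' : ∑ a ∈ {i, j}ᶜ, B (v a) (v a) = ∑ a ∈ {i, j}ᶜ, B (A a a) (A a a) :=
    Finset.sum_congr rfl fun a ha => by rw [hv a ha]
  rw [hsum, hsplit, hvi, hvj, hsum'] at hcs
  rw [hsplit fun a => B (A a a) (A a a)] at hdiag
  have hcard : (0 : ℝ) < Fintype.card ι := by
    have : Nonempty ι := ⟨i⟩
    exact_mod_cast Fintype.card_pos
  have hcs' : 1 / (Fintype.card ι : ℝ) * B (∑ a, A a a + y) (∑ a, A a a + y) ≤ _ :=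
    (le_of_eq (one_div_mul_eq_div _ _)).trans ((div_le_iff₀' hcard).2 hcs)
  simp only [map_add, add_apply, hs y, hs (A j j) (A i i)] at hcs' ⊢
  linarith

theorem sum_sum_Ioi_eq {n : ℕ} (S : Fin n → Fin n → ℝ) (hS : ∀ i j, S i j = S j i) :
    ∑ i, ∑ j ∈ Finset.Ioi i, S i j = 1 / 2 * (∑ i, ∑ j, S i j - ∑ i, S i i) := by
  have h := Finset.sum_sum_Ioi_add_eq_sum_sum_off_diag S
  have h₁ : ∑ i, ∑ j ∈ Finset.Ioi i, (S j i + S i j) = 2 * ∑ i, ∑ j ∈ Finset.Ioi i, S i j := by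
    rw [Finset.mul_sum]
    refine Finset.sum_congr rfl fun i _ => ?_
    rw [Finset.mul_sum]
    exact Finset.sum_congr rfl fun j _ => by rw [hS j i, two_mul]
  have h₂ : ∀ i, ∑ j ∈ {i}ᶜ, S j i = ∑ j, S i j - S i i := fun i => by
    rw [← Finset.sum_add_sum_compl {i} (S i)]
    simp [hS i]
  rw [h₁, Finset.sum_congr rfl fun i _ => h₂ i, Finset.sum_sub_distrib] at h
  linarith

end Frames

section Extrinsic

variable {E : Type*} [NormedAddCommGroup E] [NormedSpace ℝ E] [FiniteDimensional ℝ E]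
  {H : Type*} [TopologicalSpace H]
  {I : ModelWithCorners ℝ E H} {M : Type*} [TopologicalSpace M] [ChartedSpace H M]
  [IsManifold I ∞ M] [I.Boundaryless]
  {E' : Type*} [NormedAddCommGroup E'] [NormedSpace ℝ E'] [FiniteDimensional ℝ E']
  {H' : Type*} [TopologicalSpace H']
  {I' : ModelWithCorners ℝ E' H'} {M' : Type*} [TopologicalSpace M'] [ChartedSpace H' M']
  [IsManifold I' ∞ M'] [I'.Boundaryless]

/-- The second fundamental form as a bilinear map. -/
def secondFundamentalFormL (g : SmoothMetric I M) (g' : SmoothMetric I' M') (φ : M → M') (x : M) :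
    E →ₗ[ℝ] E →ₗ[ℝ] E' :=
  LinearMap.mk₂ ℝ (secondFundamentalForm g g' φ x)
    (fun u v w => by
      simp only [secondFundamentalForm, christoffelAt, ← christoffelL_apply, map_add, add_apply]
      abel)
    (fun a u v => by
      simp only [secondFundamentalForm, christoffelAt, ← christoffelL_apply, map_smul, smul_apply]
      module)
    (fun u v w => by
      simp only [secondFundamentalForm, christoffelAt, ← christoffelL_apply, map_add]
      abel)
    (fun a u v => by
      simp only [secondFundamentalForm, christoffelAt, ← christoffelL_apply, map_smul]
      module)

omit [I.Boundaryless] [I'.Boundaryless] in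
theorem secondFundamentalFormL_apply (g : SmoothMetric I M) (g' : SmoothMetric I' M') (φ : M → M')
    (x : M) (u v : E) :
    secondFundamentalFormL g g' φ x u v = secondFundamentalForm g g' φ x u v := rfl

omit [I.Boundaryless] [I'.Boundaryless] [FiniteDimensional ℝ E] [FiniteDimensional ℝ E'] in
theorem secondFundamentalForm_eq_sffLocal (g : SmoothMetric I M) (g' : SmoothMetric I' M')
    (φ : M → M') (x : M) (u v : E) :
    secondFundamentalForm g g' φ x u v =
      sffLocal (metricInChart g x) (metricInChart g' (φ x)) (writtenInExtChartAt I I' x φ)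
        (extChartAt I x x) u v := by
  rw [sffLocal, writtenInExtChartAt_self]
  rfl

omit [I.Boundaryless] [FiniteDimensional ℝ E] in
theorem HasConstantCurvature.curvature_eq {g : SmoothMetric I M} {c : ℝ}
    (hc : HasConstantCurvature g c) (x : M) {u v : E} (h : LinearIndependent ℝ ![u, v]) :
    metricAt g x (curvatureAt g x u v v) u =
      c * (metricAt g x u u * metricAt g x v v - metricAt g x u v ^ 2) := by
  have hne : metricAt g x u u * metricAt g x v v - metricAt g x u v ^ 2 ≠ 0 := by
    obtain ⟨w, z, a, b, d, hw, hz, hwz, ha, hd, rfl, rfl⟩ :=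
      exists_orthonormal_pair (B := metricAt g x) (fun v hv => metricAt_pos g x hv) h
    have hzw : metricAt g x z w = 0 := by rw [metricAt_symm, hwz]
    simp only [map_add, map_smul, add_apply, smul_apply, smul_eq_mul, hw, hz, hwz, hzw]
    have : a ^ 2 * d ^ 2 ≠ 0 := by positivity
    convert this using 1
    ring
  rw [← hc x u v h, sectionalCurvature, div_mul_cancel₀ _ hne]

variable {g : SmoothMetric I M} {g' : SmoothMetric I' M'} {φ : M → M'}

theorem secondFundamentalForm_symm (hφ : IsIsometricImmersion g g' φ) (x : M) (u v : E) :
    secondFundamentalForm g g' φ x u v = secondFundamentalForm g g' φ x v u := by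
  rw [secondFundamentalForm_eq_sffLocal, secondFundamentalForm_eq_sffLocal,
    (isIsometryNear_writtenInExtChartAt hφ x).sffLocal_symm]

/-- The Gauss equation for an isometric immersion into a space of constant curvature. -/
theorem gauss_constantCurvature (hφ : IsIsometricImmersion g g' φ) {c : ℝ}
    (hc : HasConstantCurvature g' c) (x : M) {u v : E} (h : LinearIndependent ℝ ![u, v]) :
    metricAt g x (curvatureAt g x u v v) u =
      c * (metricAt g x u u * metricAt g x v v - metricAt g x u v ^ 2) +
      (metricAt g' (φ x) (secondFundamentalForm g g' φ x u u) (secondFundamentalForm g g' φ x v v) -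
        metricAt g' (φ x) (secondFundamentalForm g g' φ x u v)
          (secondFundamentalForm g g' φ x u v)) := by
  have hi := isIsometryNear_writtenInExtChartAt hφ x
  have hm := hi.isometry.self_of_nhds
  have hg := hi.gauss u v v u
  simp only [← secondFundamentalForm_eq_sffLocal] at hg
  rw [writtenInExtChartAt_self, metricInChart_self, metricInChart_self] at hm hg
  set D := fderiv ℝ (writtenInExtChartAt I I' x φ) (extChartAt I x x)
  have hD : LinearIndependent ℝ ![D u, D v] := by
    have hinj : Function.Injective D := by
      refine (injective_iff_map_eq_zero D).2 fun w hw => by_contra fun hne => ?_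
      have := metricAt_pos g x hne
      rw [hm, hw] at this
      simp at this
    have e : ![D u, D v] = D.toLinearMap ∘ ![u, v] := by
      funext k
      fin_cases k <;> rfl
    rw [e]
    exact h.map' D.toLinearMap (LinearMap.ker_eq_bot.2 hinj)
  have hcurv := hc.curvature_eq (φ x) hD
  rw [← hm, ← hm, ← hm] at hcurv
  refine hg.trans ?_
  rw [secondFundamentalForm_symm hφ x v u,
    metricAt_symm g' (φ x) (secondFundamentalForm g g' φ x v v)]
  rw [← hcurv, curvatureAt]
  ring

end Extrinsic

section WarpedImmersion

variable {E₁ : Type*} [NormedAddCommGroup E₁] [NormedSpace ℝ E₁] [FiniteDimensional ℝ E₁]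
  {H₁ : Type*} [TopologicalSpace H₁]
  {I₁ : ModelWithCorners ℝ E₁ H₁} {N₁ : Type*} [TopologicalSpace N₁] [ChartedSpace H₁ N₁]
  [IsManifold I₁ ∞ N₁] [I₁.Boundaryless]
  {E₂ : Type*} [NormedAddCommGroup E₂] [NormedSpace ℝ E₂] [FiniteDimensional ℝ E₂]
  {H₂ : Type*} [TopologicalSpace H₂]
  {I₂ : ModelWithCorners ℝ E₂ H₂} {N₂ : Type*} [TopologicalSpace N₂] [ChartedSpace H₂ N₂]
  [IsManifold I₂ ∞ N₂] [I₂.Boundaryless]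
  {E' : Type*} [NormedAddCommGroup E'] [NormedSpace ℝ E'] [FiniteDimensional ℝ E']
  {H' : Type*} [TopologicalSpace H']
  {I' : ModelWithCorners ℝ E' H'} {M' : Type*} [TopologicalSpace M'] [ChartedSpace H' M']
  [IsManifold I' ∞ M'] [I'.Boundaryless]
  {g₁ : SmoothMetric I₁ N₁} {g₂ : SmoothMetric I₂ N₂} {f : N₁ → ℝ}
  {hf : ContMDiff I₁ 𝓘(ℝ, ℝ) ∞ f} {hpos : ∀ p, 0 < f p}

omit [FiniteDimensional ℝ E₁] [FiniteDimensional ℝ E₂] [I₁.Boundaryless] [I₂.Boundaryless] in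
theorem metricAt_warpedMetric (x : N₁ × N₂) (u v : E₁ × E₂) :
    metricAt (warpedMetric g₁ g₂ f hf hpos) x u v =
      metricAt g₁ x.1 u.1 v.1 + f x.1 ^ 2 * metricAt g₂ x.2 u.2 v.2 := rfl

/-- The factor `N₁` of a warped product is totally geodesic: its curvature is the ambient one. -/
theorem curvatureAt_warpedMetric_base (x : N₁ × N₂) (X Y : E₁) :
    metricAt (warpedMetric g₁ g₂ f hf hpos) x
        (curvatureAt (warpedMetric g₁ g₂ f hf hpos) x (X, 0) (Y, 0) (Y, 0)) (X, 0) =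
      metricAt g₁ x.1 (curvatureAt g₁ x.1 X Y Y) X := by
  have h := (isWarpedNear_metricInChart g₁ g₂ f hf hpos x).curvature_base X Y
  rw [metricInChart_self] at h
  refine h.trans ?_
  rw [show (extChartAt (I₁.prod I₂) x x).1 = extChartAt I₁ x.1 x.1 from rfl, metricInChart_self]
  rfl

/-- The curvature of a mixed plane of a warped product is given by the Hessian of the warping
function. -/
theorem curvatureAt_warpedMetric_mixed (x : N₁ × N₂) (V : E₂) (X : E₁) :
    metricAt (warpedMetric g₁ g₂ f hf hpos) x
        (curvatureAt (warpedMetric g₁ g₂ f hf hpos) x (0, V) (X, 0) (X, 0)) (0, V) =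
      f x.1 ^ 2 * metricAt g₂ x.2 V V *
        ((fderiv ℝ (f ∘ (extChartAt I₁ x.1).symm) (extChartAt I₁ x.1 x.1)
            (christoffelAt g₁ x.1 X X) -
          fderiv ℝ (fderiv ℝ (f ∘ (extChartAt I₁ x.1).symm)) (extChartAt I₁ x.1 x.1) X X) /
          f x.1) := by
  have h := (isWarpedNear_metricInChart g₁ g₂ f hf hpos x).curvature_fiber_base V X
  rw [show (extChartAt (I₁.prod I₂) x x).1 = extChartAt I₁ x.1 x.1 from rfl] at h
  rw [curvatureAt, h, metricAt_warpedMetric, Function.comp_apply, extChartAt_to_inv]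
  simp only [map_zero, map_smul, smul_apply, smul_eq_mul, christoffelAt]
  ring

variable {g' : SmoothMetric I' M'} {φ : N₁ × N₂ → M'}

/-- The Gauss equation for the tangent planes of the factor `N₁`. -/
theorem gauss_base (hφ : IsIsometricImmersion (warpedMetric g₁ g₂ f hf hpos) g' φ) {c : ℝ}
    (hc : HasConstantCurvature g' c) (x : N₁ × N₂) {X Y : E₁} (h : LinearIndependent ℝ ![X, Y]) :
    metricAt g₁ x.1 (curvatureAt g₁ x.1 X Y Y) X =
      c * (metricAt g₁ x.1 X X * metricAt g₁ x.1 Y Y - metricAt g₁ x.1 X Y ^ 2) +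
      (metricAt g' (φ x)
          (secondFundamentalForm (warpedMetric g₁ g₂ f hf hpos) g' φ x (X, 0) (X, 0))
          (secondFundamentalForm (warpedMetric g₁ g₂ f hf hpos) g' φ x (Y, 0) (Y, 0)) -
        metricAt g' (φ x)
          (secondFundamentalForm (warpedMetric g₁ g₂ f hf hpos) g' φ x (X, 0) (Y, 0))
          (secondFundamentalForm (warpedMetric g₁ g₂ f hf hpos) g' φ x (X, 0) (Y, 0))) := by
  have hi : LinearIndependent ℝ ![((X, 0) : E₁ × E₂), (Y, 0)] := by
    refine LinearIndependent.pair_iff.2 fun a b hab => LinearIndependent.pair_iff.1 h a b ?_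
    simpa using congrArg Prod.fst hab
  have := gauss_constantCurvature hφ hc x hi
  rw [curvatureAt_warpedMetric_base] at this
  simpa [metricAt_warpedMetric] using this

theorem sectionalCurvature_base (hφ : IsIsometricImmersion (warpedMetric g₁ g₂ f hf hpos) g' φ)
    {c : ℝ} (hc : HasConstantCurvature g' c) (x : N₁ × N₂) {w z : E₁}
    (hw : metricAt g₁ x.1 w w = 1) (hz : metricAt g₁ x.1 z z = 1) (hwz : metricAt g₁ x.1 w z = 0)
    (a b d : ℝ) (h : LinearIndependent ℝ ![a • w, b • w + d • z]) :
    sectionalCurvature g₁ x.1 (a • w) (b • w + d • z) = c +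
      (metricAt g' (φ x)
          (secondFundamentalForm (warpedMetric g₁ g₂ f hf hpos) g' φ x (w, 0) (w, 0))
          (secondFundamentalForm (warpedMetric g₁ g₂ f hf hpos) g' φ x (z, 0) (z, 0)) -
        metricAt g' (φ x)
          (secondFundamentalForm (warpedMetric g₁ g₂ f hf hpos) g' φ x (w, 0) (z, 0))
          (secondFundamentalForm (warpedMetric g₁ g₂ f hf hpos) g' φ x (w, 0) (z, 0))) := by
  have ha : a ≠ 0 := fun ha => h.ne_zero 0 (by simp [ha])
  have hd : d ≠ 0 := by
    rintro rfl
    have := LinearIndependent.pair_iff.1 h b (-a) (by module)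
    exact ha (neg_eq_zero.1 this.2)
  have hzw : metricAt g₁ x.1 z w = 0 := by rw [metricAt_symm, hwz]
  have e₁ : ((a • w, 0) : E₁ × E₂) = a • (w, 0) := by simp
  have e₂ : ((b • w + d • z, 0) : E₁ × E₂) = b • (w, 0) + d • (z, 0) := by simp
  have hzw' := secondFundamentalForm_symm hφ x (z, 0) (w, 0)
  rw [sectionalCurvature, gauss_base hφ hc x h, e₁, e₂]
  simp only [← secondFundamentalFormL_apply] at hzw' ⊢
  simp only [map_add, map_smul, LinearMap.add_apply, LinearMap.smul_apply, add_apply, smul_apply,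
    smul_eq_mul, hw, hz, hwz, hzw, hzw']
  have hs := metricAt_symm g' (φ x)
    (secondFundamentalFormL (warpedMetric g₁ g₂ f hf hpos) g' φ x (w, 0) (z, 0))
    (secondFundamentalFormL (warpedMetric g₁ g₂ f hf hpos) g' φ x (w, 0) (w, 0))
  have hne : a ^ 2 * d ^ 2 ≠ 0 := by positivity
  rw [hs, div_eq_iff (fun h0 => hne (by linear_combination h0))]
  ring

/-- The Gauss equation for the mixed planes bounds the Hessian of the warping function. -/
theorem hessian_le (hφ : IsIsometricImmersion (warpedMetric g₁ g₂ f hf hpos) g' φ) {c : ℝ}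
    (hc : HasConstantCurvature g' c) (x : N₁ × N₂) {V : E₂} {X : E₁}
    (hV : f x.1 ^ 2 * metricAt g₂ x.2 V V = 1) (hX : metricAt g₁ x.1 X X = 1) :
    (fderiv ℝ (f ∘ (extChartAt I₁ x.1).symm) (extChartAt I₁ x.1 x.1) (christoffelAt g₁ x.1 X X) -
        fderiv ℝ (fderiv ℝ (f ∘ (extChartAt I₁ x.1).symm)) (extChartAt I₁ x.1 x.1) X X) / f x.1 ≤
      c + metricAt g' (φ x)
        (secondFundamentalForm (warpedMetric g₁ g₂ f hf hpos) g' φ x (X, 0) (X, 0))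
        (secondFundamentalForm (warpedMetric g₁ g₂ f hf hpos) g' φ x (0, V) (0, V)) := by
  have hX0 : X ≠ 0 := by
    rintro rfl
    simp at hX
  have hV0 : V ≠ 0 := by
    rintro rfl
    simp at hV
  have hi : LinearIndependent ℝ ![((0, V) : E₁ × E₂), (X, 0)] := by
    refine LinearIndependent.pair_iff.2 fun a b hab => ?_
    have h₁ := congrArg Prod.fst hab
    have h₂ := congrArg Prod.snd hab
    simp [hX0, hV0] at h₁ h₂
    exact ⟨h₂, h₁⟩
  have := gauss_constantCurvature hφ hc x hi
  rw [curvatureAt_warpedMetric_mixed, hV, metricAt_symm g' (φ x)] at this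
  simp only [metricAt_warpedMetric, map_zero, zero_apply, zero_add, mul_zero, add_zero, hV,
    hX] at this
  have hn := metricAt_nonneg g' (φ x)
    (secondFundamentalForm (warpedMetric g₁ g₂ f hf hpos) g' φ x (0, V) (X, 0))
  linarith

omit [I₁.Boundaryless] [I₂.Boundaryless] [I'.Boundaryless] in
/-- The trace of the second fundamental form of a warped product, computed in a frame adapted to
the two factors. -/
theorem smul_meanCurvature_warped (x : N₁ × N₂)
    {e : Fin (Module.finrank ℝ E₁) → E₁} (he : IsOrthonormalFrame (metricAt g₁ x.1) e)
    {ε : Fin (Module.finrank ℝ E₂) → E₂} (hε : IsOrthonormalFrame (metricAt g₂ x.2) ε)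
    (hn : Module.finrank ℝ E₁ ≠ 0) :
    ((Module.finrank ℝ E₁ : ℝ) + Module.finrank ℝ E₂) •
        meanCurvature (warpedMetric g₁ g₂ f hf hpos) g' φ x =
      ∑ a, secondFundamentalForm (warpedMetric g₁ g₂ f hf hpos) g' φ x (e a, 0) (e a, 0) +
        ∑ s, secondFundamentalForm (warpedMetric g₁ g₂ f hf hpos) g' φ x
          (0, (f x.1)⁻¹ • ε s) (0, (f x.1)⁻¹ • ε s) := by
  let G := warpedMetric g₁ g₂ f hf hpos
  let o : Fin (Module.finrank ℝ E₁) ⊕ Fin (Module.finrank ℝ E₂) → E₁ × E₂ :=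
    Sum.elim (fun a => (e a, 0)) (fun s => (0, (f x.1)⁻¹ • ε s))
  have hfx := (hpos x.1).ne'
  have he' : ∀ i j, metricAt g₁ x.1 (e i) (e j) = if i = j then 1 else 0 := he
  have hε' : ∀ i j, metricAt g₂ x.2 (ε i) (ε j) = if i = j then 1 else 0 := hε
  have ho : ∀ i j, metricAt G x (o i) (o j) = if i = j then 1 else 0 := by
    rintro (i | i) (j | j) <;>
      simp [o, G, metricAt_warpedMetric, he', hε']
    field_simp
  have hframe : IsOrthonormalFrame (metricAt G x) (orthonormalFrame G x) :=
    isOrthonormalFrame_orthonormalFrame G x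
  have ht := sum_diag_eq_of_orthonormal (metricAt_symm G x) hframe (Fintype.card_fin _) ho
    (by simp [Module.finrank_prod]) (secondFundamentalFormL G g' φ x)
  have hne : ((Module.finrank ℝ E₁ : ℝ) + Module.finrank ℝ E₂) ≠ 0 := by
    have : (0 : ℝ) < Module.finrank ℝ E₁ := by exact_mod_cast Nat.pos_of_ne_zero hn
    positivity
  simp only [secondFundamentalFormL_apply] at ht
  rw [meanCurvature, ht, Module.finrank_prod, Nat.cast_add, smul_smul, mul_one_div_cancel hne,
    one_smul, Fintype.sum_sum_type]
  rfl

/-- Chen's inequality for an arbitrary tangent plane of `N₁`, with a defect term. -/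
theorem chen_inequality_plane (hφ : IsIsometricImmersion (warpedMetric g₁ g₂ f hf hpos) g' φ)
    {c : ℝ} (hc : HasConstantCurvature g' c) (hn : 2 ≤ Module.finrank ℝ E₁) (x : N₁ × N₂)
    {u v : E₁} (h : LinearIndependent ℝ ![u, v]) :
    scalarCurvature g₁ x.1 - sectionalCurvature g₁ x.1 u v +
        Module.finrank ℝ E₂ * laplacian g₁ f x.1 / f x.1 ≤
      1 / 2 * (1 - 1 / (Module.finrank ℝ E₁ : ℝ)) *
          (((Module.finrank ℝ E₁ : ℝ) + Module.finrank ℝ E₂) ^ 2 *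
            metricAt g' (φ x) (meanCurvature (warpedMetric g₁ g₂ f hf hpos) g' φ x)
              (meanCurvature (warpedMetric g₁ g₂ f hf hpos) g' φ x)) +
        (1 / 2 * Module.finrank ℝ E₁ * (Module.finrank ℝ E₁ + 2 * Module.finrank ℝ E₂ - 1) * c -
          c) := by
  let G := warpedMetric g₁ g₂ f hf hpos
  let B := metricAt g' (φ x)
  let L := secondFundamentalFormL G g' φ x
  let α : E₁ →ₗ[ℝ] E₁ →ₗ[ℝ] E' := L.compl₁₂ (LinearMap.inl ℝ E₁ E₂) (LinearMap.inl ℝ E₁ E₂)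
  have hα : ∀ X Y, α X Y = secondFundamentalForm G g' φ x (X, 0) (Y, 0) := fun _ _ => rfl
  have hαs : ∀ X Y, α X Y = α Y X := fun X Y => secondFundamentalForm_symm hφ x _ _
  have hs₁ := metricAt_symm g₁ x.1
  have hBs : ∀ a b, B a b = B b a := metricAt_symm g' (φ x)
  have hBp : ∀ a, 0 ≤ B a a := metricAt_nonneg g' (φ x)
  obtain ⟨w, z, a, b, d, hw, hz, hwz, -, -, rfl, rfl⟩ :=
    exists_orthonormal_pair (B := metricAt g₁ x.1) (fun v hv => metricAt_pos g₁ x.1 hv) h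
  obtain ⟨e, he, hei, hej⟩ := exists_frame_extending hs₁ (fun v hv => metricAt_pos g₁ x.1 hv)
    hw hz hwz ⟨0, by omega⟩ ⟨1, by omega⟩ (by simp)
  have hfr : IsOrthonormalFrame (metricAt g₁ x.1) (orthonormalFrame g₁ x.1) :=
    isOrthonormalFrame_orthonormalFrame g₁ x.1
  have hfr₂ : IsOrthonormalFrame (metricAt g₂ x.2) (orthonormalFrame g₂ x.2) :=
    isOrthonormalFrame_orthonormalFrame g₂ x.2
  set o := orthonormalFrame g₁ x.1 with ho
  set ε := orthonormalFrame g₂ x.2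
  have htr : ∑ a, α (o a) (o a) = ∑ a, α (e a) (e a) :=
    sum_diag_eq_of_orthonormal hs₁ hfr (Fintype.card_fin _) he (Fintype.card_fin _) α
  have hnorm : ∑ a, ∑ b, B (α (o a) (o b)) (α (o a) (o b)) =
      ∑ a, ∑ b, B (α (e a) (e b)) (α (e a) (e b)) := by
    have hsq : ∀ X, ∑ b, B (α X (o b)) (α X (o b)) = ∑ b, B (α X (e b)) (α X (e b)) := fun X =>
      sum_diag_eq_of_orthonormal hs₁ hfr (Fintype.card_fin _) he (Fintype.card_fin _)
        ((ContinuousLinearMap.toLinearMap₁₂ B).compl₁₂ (α X) (α X))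
    simp only [hsq]
    rw [Finset.sum_comm, Finset.sum_comm (f := fun a b => B (α (e a) (e b)) (α (e a) (e b)))]
    refine Finset.sum_congr rfl fun b _ => ?_
    simp only [hαs _ (e b), hsq]
  -- the scalar curvature
  have hτ : scalarCurvature g₁ x.1 = 1 / 2 * (Module.finrank ℝ E₁ * (Module.finrank ℝ E₁ - 1) * c +
      (B (∑ a, α (e a) (e a)) (∑ a, α (e a) (e a)) -
        ∑ a, ∑ b, B (α (e a) (e b)) (α (e a) (e b)))) := by
    let S : Fin (Module.finrank ℝ E₁) → Fin (Module.finrank ℝ E₁) → ℝ := fun i j =>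
      c + (B (α (o i) (o i)) (α (o j) (o j)) - B (α (o i) (o j)) (α (o i) (o j)))
    have hS : scalarCurvature g₁ x.1 = ∑ i, ∑ j ∈ Finset.Ioi i, S i j := by
      refine Finset.sum_congr rfl fun i _ => Finset.sum_congr rfl fun j hj => ?_
      have hij : i ≠ j := (Finset.mem_Ioi.1 hj).ne
      have hli : LinearIndependent ℝ ![(1 : ℝ) • o i, (0 : ℝ) • o i + (1 : ℝ) • o j] := by
        rw [one_smul, zero_smul, zero_add, one_smul]
        refine LinearIndependent.pair_iff.2 fun s t hst => ⟨?_, ?_⟩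
        · simpa [hfr i i, hfr j i, hij.symm] using congrArg (fun v => metricAt g₁ x.1 v (o i)) hst
        · simpa [hfr i j, hfr j j, hij] using congrArg (fun v => metricAt g₁ x.1 v (o j)) hst
      have := sectionalCurvature_base hφ hc x (w := o i) (z := o j) (by simp [hfr i i])
        (by simp [hfr j j]) (by simp [hfr i j, hij]) 1 0 1 hli
      rw [one_smul, zero_smul, zero_add, one_smul] at this
      exact this
    rw [hS, sum_sum_Ioi_eq S fun i j => by simp only [S]; rw [hBs, hαs (o i) (o j)]]
    simp only [S, Finset.sum_add_distrib, Finset.sum_sub_distrib, Finset.sum_const,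
      Finset.card_univ, Fintype.card_fin, nsmul_eq_mul, sub_self, ← map_sum, hnorm]
    rw [← sum_apply, ← map_sum, htr]
    ring
  have hK : sectionalCurvature g₁ x.1 (a • w) (b • w + d • z) =
      c + (B (α w w) (α z z) - B (α w z) (α w z)) :=
    sectionalCurvature_base hφ hc x hw hz hwz a b d h
  -- the Laplacian of the warping function
  let y : E' := ∑ s, secondFundamentalForm G g' φ x (0, (f x.1)⁻¹ • ε s) (0, (f x.1)⁻¹ • ε s)
  have hΔ : Module.finrank ℝ E₂ * laplacian g₁ f x.1 / f x.1 ≤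
      Module.finrank ℝ E₁ * Module.finrank ℝ E₂ * c + B (∑ a, α (e a) (e a)) y := by
    have hfx := (hpos x.1).ne'
    have hs : ∀ s, laplacian g₁ f x.1 / f x.1 ≤ Module.finrank ℝ E₁ * c +
        B (∑ a, α (e a) (e a))
          (secondFundamentalForm G g' φ x (0, (f x.1)⁻¹ • ε s) (0, (f x.1)⁻¹ • ε s)) := by
      intro s
      have hV : f x.1 ^ 2 * metricAt g₂ x.2 ((f x.1)⁻¹ • ε s) ((f x.1)⁻¹ • ε s) = 1 := by
        simp only [map_smul, smul_apply, smul_eq_mul, hfr₂ s s, if_true]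
        field_simp
      rw [laplacian, Finset.sum_div, ← htr, map_sum, sum_apply]
      refine (Finset.sum_le_sum fun a _ =>
        hessian_le hφ hc x (X := o a) hV (by simp [hfr a a])).trans (le_of_eq ?_)
      rw [Finset.sum_add_distrib]
      simp
      rfl
    have := Finset.sum_le_sum fun s (_ : s ∈ Finset.univ) => hs s
    simp only [Finset.sum_add_distrib, Finset.sum_const, Finset.card_univ, Fintype.card_fin,
      nsmul_eq_mul, ← map_sum] at this
    rw [mul_div_assoc]
    linarith
  have hH := smul_meanCurvature_warped (hf := hf) (hpos := hpos) (g' := g') (φ := φ) x he hfr₂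
    (by omega)
  have hchen := chen_algebraic hBs hBp (fun a b => α (e a) (e b)) (fun a b => hαs _ _) y
    (i := ⟨0, by omega⟩) (j := ⟨1, by omega⟩) (by simp)
  have hnH : ∑ a, α (e a) (e a) + y = ((Module.finrank ℝ E₁ : ℝ) + Module.finrank ℝ E₂) •
      meanCurvature (warpedMetric g₁ g₂ f hf hpos) g' φ x := hH.symm
  rw [hnH, hei, hej, Fintype.card_fin] at hchen
  simp only [map_smul, smul_apply, smul_eq_mul] at hchen
  rw [hτ, hK]
  change _ ≤ 1 / 2 * (1 - 1 / (Module.finrank ℝ E₁ : ℝ)) * (_ * B _ _) + _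
  linarith

/-- Chen's inequality for warped products, with a defect term that detects the equality case. -/
theorem chen_inequality (hφ : IsIsometricImmersion (warpedMetric g₁ g₂ f hf hpos) g' φ)
    {c : ℝ} (hc : HasConstantCurvature g' c) (hn : 2 ≤ Module.finrank ℝ E₁) (x : N₁ × N₂) :
    chenInvariant g₁ x.1 + Module.finrank ℝ E₂ * laplacian g₁ f x.1 / f x.1 ≤
      1 / 2 * (1 - 1 / (Module.finrank ℝ E₁ : ℝ)) *
          (((Module.finrank ℝ E₁ : ℝ) + Module.finrank ℝ E₂) ^ 2 *
            metricAt g' (φ x) (meanCurvature (warpedMetric g₁ g₂ f hf hpos) g' φ x)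
              (meanCurvature (warpedMetric g₁ g₂ f hf hpos) g' φ x)) +
        (1 / 2 * Module.finrank ℝ E₁ * (Module.finrank ℝ E₁ + 2 * Module.finrank ℝ E₂ - 1) * c -
          c) := by
  have hne : {k : ℝ | ∃ u v : E₁, LinearIndependent ℝ ![u, v] ∧
      sectionalCurvature g₁ x.1 u v = k}.Nonempty := by
    let b := Module.finBasis ℝ E₁
    refine ⟨_, b ⟨0, by omega⟩, b ⟨1, by omega⟩, ?_, rfl⟩
    have e : ![b ⟨0, by omega⟩, b ⟨1, by omega⟩] = b ∘ ![⟨0, by omega⟩, ⟨1, by omega⟩] := by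
      funext k
      fin_cases k <;> rfl
    rw [e]
    refine b.linearIndependent.comp _ fun k l hkl => ?_
    fin_cases k <;> fin_cases l <;> simp at hkl ⊢
  rw [chenInvariant, sub_add_eq_add_sub, sub_le_comm]
  refine le_csInf hne ?_
  rintro k ⟨u, v, h, rfl⟩
  have := chen_inequality_plane hφ hc hn x h
  linarith

end WarpedImmersion

end WarpedChen

end

theorem corollary5p1 {n₁ n₂ m : ℕ} (hn₁ : 2 ≤ n₁)
    {N₁ : Type*} [TopologicalSpace N₁] [ChartedSpace (EuclideanSpace ℝ (Fin n₁)) N₁]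
    [IsManifold (𝓡 n₁) ∞ N₁]
    {N₂ : Type*} [TopologicalSpace N₂] [ChartedSpace (EuclideanSpace ℝ (Fin n₂)) N₂]
    [IsManifold (𝓡 n₂) ∞ N₂]
    {M' : Type*} [TopologicalSpace M'] [ChartedSpace (EuclideanSpace ℝ (Fin m)) M']
    [IsManifold (𝓡 m) ∞ M']
    (g₁ : WarpedChen.SmoothMetric (𝓡 n₁) N₁) (g₂ : WarpedChen.SmoothMetric (𝓡 n₂) N₂)
    (g' : WarpedChen.SmoothMetric (𝓡 m) M') (c : ℝ)
    (hc : WarpedChen.HasConstantCurvature g' c)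
    (f : N₁ → ℝ) (hf : ContMDiff (𝓡 n₁) 𝓘(ℝ, ℝ) ∞ f) (hpos : ∀ p, 0 < f p)
    (φ : N₁ × N₂ → M')
    (hφ : WarpedChen.IsIsometricImmersion (WarpedChen.warpedMetric g₁ g₂ f hf hpos) g' φ) :
    -- the necessary condition for minimality
    (WarpedChen.IsMinimalImmersion (WarpedChen.warpedMetric g₁ g₂ f hf hpos) g' φ →
      ∀ x : N₁ × N₂,
        WarpedChen.chenInvariant g₁ x.1 + n₂ * WarpedChen.laplacian g₁ f x.1 / f x.1 ≤
          1 / 2 * n₁ * (n₁ + 2 * n₂ - 1) * c - c) ∧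
    -- the inequality for an arbitrary isometric immersion; equality at a point forces `H = 0` there
    (∀ x : N₁ × N₂,
      let H := WarpedChen.meanCurvature (WarpedChen.warpedMetric g₁ g₂ f hf hpos) g' φ x
      let lhs := WarpedChen.chenInvariant g₁ x.1 + n₂ * WarpedChen.laplacian g₁ f x.1 / f x.1
      let rhs := ((n₁ : ℝ) + n₂) ^ 2 / 2 * WarpedChen.metricAt g' (φ x) H H
        + 1 / 2 * n₁ * (n₁ + 2 * n₂ - 1) * c - c
      lhs ≤ rhs ∧ (lhs = rhs → H = 0)) ∧
    -- equality at every point forces minimality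
    ((∀ x : N₁ × N₂,
      let H := WarpedChen.meanCurvature (WarpedChen.warpedMetric g₁ g₂ f hf hpos) g' φ x
      WarpedChen.chenInvariant g₁ x.1 + n₂ * WarpedChen.laplacian g₁ f x.1 / f x.1 =
        ((n₁ : ℝ) + n₂) ^ 2 / 2 * WarpedChen.metricAt g' (φ x) H H
          + 1 / 2 * n₁ * (n₁ + 2 * n₂ - 1) * c - c) →
      WarpedChen.IsMinimalImmersion (WarpedChen.warpedMetric g₁ g₂ f hf hpos) g' φ) := by
  have hr₁ : Module.finrank ℝ (EuclideanSpace ℝ (Fin n₁)) = n₁ := finrank_euclideanSpace_fin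
  have hr₂ : Module.finrank ℝ (EuclideanSpace ℝ (Fin n₂)) = n₂ := finrank_euclideanSpace_fin
  have key := WarpedChen.chen_inequality hφ hc (hn₁.trans_eq hr₁.symm)
  simp only [hr₁, hr₂] at key
  have hn₁' : (0 : ℝ) < n₁ := by
    have : 0 < n₁ := by omega
    exact_mod_cast this
  have hdefect : ∀ x : N₁ × N₂,
      let H := WarpedChen.meanCurvature (WarpedChen.warpedMetric g₁ g₂ f hf hpos) g' φ x
      let lhs := WarpedChen.chenInvariant g₁ x.1 + n₂ * WarpedChen.laplacian g₁ f x.1 / f x.1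
      let rhs := ((n₁ : ℝ) + n₂) ^ 2 / 2 * WarpedChen.metricAt g' (φ x) H H
        + 1 / 2 * n₁ * (n₁ + 2 * n₂ - 1) * c - c
      lhs ≤ rhs ∧ (lhs = rhs → H = 0) := by
    intro x H lhs rhs
    have hx : lhs ≤ rhs - ((n₁ : ℝ) + n₂) ^ 2 / (2 * n₁) * WarpedChen.metricAt g' (φ x) H H := by
      refine (key x).trans (le_of_eq ?_)
      simp only [rhs, H]
      field_simp
      ring
    refine ⟨hx.trans (sub_le_self _ (mul_nonneg (by positivity)
      (WarpedChen.metricAt_nonneg g' (φ x) H))), fun heq => by_contra fun hH => ?_⟩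
    have : 0 < ((n₁ : ℝ) + n₂) ^ 2 / (2 * n₁) * WarpedChen.metricAt g' (φ x) H H :=
      mul_pos (by positivity) (WarpedChen.metricAt_pos g' (φ x) hH)
    linarith
  refine ⟨fun hmin x => ?_, hdefect, fun heq x => (hdefect x).2 (heq x)⟩
  have h := (hdefect x).1
  simp only [hmin x, map_zero, mul_zero, zero_add] at h
  exact h
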